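/- Let $\mathbb K$ be a field. For a finite simple graph $G$ let $S_G=\mathbb K[x_v : v\in V(G)]$ and let $I_G=(x_ux_v : \{u,v\}\in E(G))\subset S_G$ be its edge ideal. For an $S_G$-module $M$ let $\operatorname{depth}(M)=\min\{i : \operatorname{Ext}^i_{S_G}(\mathbb K,M)\neq 0\}$, where $\mathbb K=S_G/(x_v : v\in V(G))$. A $k$-fan graph $F_k^W(K_n)$ is obtained as follows from the complete graph $K_n$ on $[n]$, a subset $W\subseteq[n]$ and a partition $W=W_1\sqcup\cdots\sqcup W_k$ into nonempty sets $W_i=\{w_{i,1},\dots,w_{i,r_i}\}$: for each $i\in[k]$ and $j\in[r_i]$ attach a complete graph $K_{a_{i,j}}$ with $a_{i,j}>j$ so that $V(K_n)\cap V(K_{a_{i,j}})=\{w_{i,1},\dots,w_{i,j}\}$, the $a_{i,j}-j$ new vertices of different attached complete graphs being disjoint. For graphs $G_1,G_2$ with leaves $f_1,f_2$, let $(G_1,f_1)*(G_2,f_2)$ be the graph obtained from the disjoint union of $G_1$ and $G_2$ by identifying $f_1$ with $f_2$. **Theorem.** For $i=1,2$ let $G_i=F_{k_i}^{W_i}(K_{n_i})$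 be a $k_i$-fan graph with $n_i\ge 2$ and $k_i\ge 1$, let $f_i$ be a leaf of $G_i$ with neighbor $v_i$, and let $W_i=W_{i,1}\sqcup\cdots\sqcup W_{i,k_i}$ be the corresponding partition of $W_i$, numbered so that $v_i\in W_{i,1}$. Let $G=(G_1,f_1)*(G_2,f_2)$, and put $$T_i=\max\{|W_{i,1}|,|W_{i,2}|,\dots,|W_{i,k_i}|\},\qquad T_i'=\max\{|W_{i,1}|-1,|W_{i,2}|,\dots,|W_{i,k_i}|\},\qquad t=|\{i\in\{1,2\} : T_i'\neq T_i-1\}|.$$ Then $$\operatorname{depth}(S_G/I_G)=\operatorname{depth}(S_{G_1}/I_{G_1})+\operatorname{depth}(S_{G_2}/I_{G_2})-s,$$ where $s=0$ if $t=0$, and $s=1$ otherwise. -/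

import Mathlib

open CategoryTheory

universe u

/-- The data of a `k`-fan graph of the complete graph `K_n` on the vertex set `Fin n`: pairwise
disjoint nonempty ordered subsets `W_i = {w i 0, …, w i (r i - 1)}` of `Fin n`, for `i : Fin k`, and,
for each `i` and each position `j`, the number `h i j ≥ 1` of new vertices of the `j`-th clique of
the fan on `W_i`.  With positions counted from `0`, this clique contains `w i 0, …, w i j`, so it has
`a_{i,j} = (j + 1) + h i j > j + 1` vertices. -/
structure Fan (n k : ℕ) where
  r : Fin k → ℕ
  r_pos : ∀ i, 0 < r i
  w : (i : Fin k) → Fin (r i) → Fin n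
  w_injective : Function.Injective fun p : (i : Fin k) × Fin (r i) => w p.1 p.2
  h : (i : Fin k) → Fin (r i) → ℕ
  h_pos : ∀ i j, 0 < h i j

namespace Fan

variable {n k : ℕ} (F : Fan n k)

/-- The vertices of `F_k^W(K_n)`: those of `K_n`, and for each branch clique its new vertices. -/
abbrev Vertex : Type :=
  Fin n ⊕ ((i : Fin k) × (j : Fin (F.r i)) × Fin (F.h i j))

/-- The part `W_i` of the partition of `W`. -/
def part (i : Fin k) : Finset (Fin n) :=
  Finset.univ.image (F.w i)

/-- The vertex set of the branch clique `K_{a_{i,j}}`: the first `j` elements of `W_i` (counted up to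
and including position `j`), together with the new vertices of that clique. -/
def branch (i : Fin k) (j : Fin (F.r i)) : Set F.Vertex :=
  {x | (∃ j', j' ≤ j ∧ x = Sum.inl (F.w i j')) ∨ ∃ y : Fin (F.h i j), x = Sum.inr ⟨i, j, y⟩}

/-- The `k`-fan graph `F_k^W(K_n)`: two distinct vertices are adjacent if and only if they both lie in
`K_n` or both lie in one of the branch cliques. -/
def graph : SimpleGraph F.Vertex where
  Adj x y := x ≠ y ∧
    ((∃ a b : Fin n, x = Sum.inl a ∧ y = Sum.inl b) ∨
      ∃ i j, x ∈ F.branch i j ∧ y ∈ F.branch i j)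
  symm := ⟨by
    rintro x y ⟨hne, ⟨a, b, ha, hb⟩ | ⟨i, j, hx, hy⟩⟩
    · exact ⟨hne.symm, Or.inl ⟨b, a, hb, ha⟩⟩
    · exact ⟨hne.symm, Or.inr ⟨i, j, hy, hx⟩⟩⟩
  loopless := ⟨fun _ hx => hx.1 rfl⟩

/-- `T = max {|W_1|, …, |W_k|}`. -/
def maxPart : ℕ :=
  Finset.univ.sup fun i => (F.part i).card

/-- `T' = max {|W_c| - 1, |W_i| : i ≠ c}`. -/
def maxPart' (c : Fin k) : ℕ :=
  Finset.univ.sup fun i => if i = c then (F.part i).card - 1 else (F.part i).card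

end Fan

/-- `f` is a leaf of `G` with (only) neighbor `v`. -/
def IsLeafAt {V : Type*} (G : SimpleGraph V) (f v : V) : Prop :=
  G.neighborSet f = {v}

/-- The map from the second vertex set to the vertex set of `(G₁, f₁) * (G₂, f₂)`; it sends `f₂` to
the vertex `f₁`. -/
def starInr {V₁ V₂ : Type*} [DecidableEq V₂] (f₁ : V₁) (f₂ : V₂) (x : V₂) :
    V₁ ⊕ {y : V₂ // y ≠ f₂} :=
  if h : x = f₂ then Sum.inl f₁ else Sum.inr ⟨x, h⟩

/-- The graph `(G₁, f₁) * (G₂, f₂)`, obtained from the disjoint union of `G₁` and `G₂` by identifying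
`f₂` with `f₁`. -/
def starGraph {V₁ V₂ : Type*} [DecidableEq V₂] (G₁ : SimpleGraph V₁) (f₁ : V₁)
    (G₂ : SimpleGraph V₂) (f₂ : V₂) : SimpleGraph (V₁ ⊕ {y : V₂ // y ≠ f₂}) :=
  G₁.map Sum.inl ⊔ G₂.map (starInr f₁ f₂)

/-- The edge ideal `I_G` in the polynomial ring `S_G = 𝕜[x_v : v ∈ V]`. -/
noncomputable def edgeIdeal (𝕜 : Type u) [Field 𝕜] {V : Type} (G : SimpleGraph V) : Ideal (MvPolynomial V 𝕜) :=
  Ideal.span {p | ∃ x y, G.Adj x y ∧ p = MvPolynomial.X x * MvPolynomial.X y}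

/-- The depth of a module `M` over `S = 𝕜[x_v : v ∈ V]`, namely `min {i | Ext^i_S(𝕜, M) ≠ 0}`, where
`𝕜 = S / (x_v : v ∈ V)`.  The value is `⊤` if there is no such `i`. -/
noncomputable def depth (𝕜 : Type u) [Field 𝕜] (V : Type) (M : Type u) [AddCommGroup M]
    [Module (MvPolynomial V 𝕜) M] : ℕ∞ :=
  sInf {d : ℕ∞ | ∃ i : ℕ, d = i ∧
    Nontrivial (Abelian.Ext
      (ModuleCat.of (MvPolynomial V 𝕜)
        (MvPolynomial V 𝕜 ⧸ Ideal.span (Set.range (MvPolynomial.X : V → MvPolynomial V 𝕜))))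
      (ModuleCat.of (MvPolynomial V 𝕜) M) i)}

/-- `depth (S_G / I_G)`. -/
noncomputable def graphDepth (𝕜 : Type u) [Field 𝕜] {V : Type} (G : SimpleGraph V) : ℕ∞ :=
  depth 𝕜 V (MvPolynomial V 𝕜 ⧸ edgeIdeal 𝕜 G)

/-! Gluing two fan graphs at leaves gives a chordal graph, and for a chordal graph the depth of
`S/I` is the least size of a maximal independent set (`graphDepth_eq_of_isEliminationRank`). For any
complex, a facet of size `d` forces `Ext^d(𝕜, S/I) ≠ 0` (`nontrivial_ext_of_facet`). Conversely, the
sequence `0 → S/(I : x) → S/I → S/(I, x) → 0`, with `x` the variable of a neighbor of a simplicial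
vertex, gives the lower bound by induction on the vertex set (`extVanishesBelow_indepComplex`).

What remains is counting. In a fan graph each branch clique must be met, and at most one vertex of
`K_n` is available; the best choice is the first vertex of a largest part, so the minimum is the
number of branch cliques plus 1 minus `T`. In the glued graph the leaf is shared. One vertex is
saved when some side has a minimum set that contains the leaf and still dominates everything else
without it; otherwise every minimum set on either side avoids the leaf and nothing is saved.
`Fan.leafProfile` shows that the saving occurs precisely when a part not containing the neighbor of
the leaf has size `T`, which is the condition `T' ≠ T - 1`. -/

/-! ### Ext and the short exact sequence of a colon ideal -/

section ColonSequence

open Abelian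

variable {R : Type u} [CommRing R] {I I' I'' : Ideal R} {x : R}

/-- Multiplication by `x` as a map `R / (I : x) → R / I`. -/
noncomputable def colonMul (h : ∀ a, x * a ∈ I ↔ a ∈ I') : R ⧸ I' →ₗ[R] R ⧸ I :=
  Submodule.mapQ I' I (LinearMap.lsmul R R x) fun a ha => (h a).2 ha

lemma colonMul_mk (h : ∀ a, x * a ∈ I ↔ a ∈ I') (a : R) :
    colonMul h (Submodule.Quotient.mk a) = Submodule.Quotient.mk (x * a) :=
  rfl

lemma colonMul_injective (h : ∀ a, x * a ∈ I ↔ a ∈ I') : Function.Injective (colonMul h) := by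
  rw [injective_iff_map_eq_zero]
  intro a ha
  obtain ⟨a, rfl⟩ := Submodule.Quotient.mk_surjective _ a
  rw [colonMul_mk, Submodule.Quotient.mk_eq_zero] at ha
  rw [Submodule.Quotient.mk_eq_zero]
  exact (h a).1 ha

/-- The short complex `R / (I : x) → R / I → R / (I, x)`. -/
noncomputable abbrev colonComplex (h : ∀ a, x * a ∈ I ↔ a ∈ I') (h' : I'' = I ⊔ Ideal.span {x}) :
    ShortComplex (ModuleCat.{u} R) :=
  ModuleCat.shortComplexOfCompEqZero (colonMul h)
    (Submodule.factor (h' ▸ le_sup_left : I ≤ I'')) (by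
      ext
      change (Submodule.Quotient.mk (x * 1) : R ⧸ I'') = 0
      rw [Submodule.Quotient.mk_eq_zero, mul_one, h']
      exact Ideal.mem_sup_right (Ideal.mem_span_singleton_self x))

lemma colonComplex_shortExact (h : ∀ a, x * a ∈ I ↔ a ∈ I') (h' : I'' = I ⊔ Ideal.span {x}) :
    (colonComplex h h').ShortExact := by
  have hle : I ≤ I'' := h' ▸ le_sup_left
  refine ModuleCat.shortComplex_shortExact _ ?_ (colonMul_injective h)
    (Submodule.factor_surjective hle)
  intro b
  obtain ⟨b, rfl⟩ := Submodule.Quotient.mk_surjective _ b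
  change (Submodule.Quotient.mk b : R ⧸ I'') = 0 ↔ Submodule.Quotient.mk b ∈ Set.range (colonMul h)
  rw [Submodule.Quotient.mk_eq_zero, h', Submodule.mem_sup]
  constructor
  · rintro ⟨a, ha, y, hy, rfl⟩
    obtain ⟨z, rfl⟩ := Ideal.mem_span_singleton'.1 hy
    refine ⟨Submodule.Quotient.mk z, ?_⟩
    rw [colonMul_mk, Submodule.Quotient.eq]
    convert I.neg_mem ha using 1
    ring
  · rintro ⟨z, hz⟩
    obtain ⟨z, rfl⟩ := Submodule.Quotient.mk_surjective _ z
    rw [colonMul_mk, Submodule.Quotient.eq] at hz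
    refine ⟨b - x * z, by simpa using I.neg_mem hz, x * z, ?_, by ring⟩
    exact Ideal.mul_mem_right _ _ (Ideal.mem_span_singleton_self x)

lemma colonComplex_f (h : ∀ a, x * a ∈ I ↔ a ∈ I) (h' : I'' = I ⊔ Ideal.span {x}) :
    (colonComplex h h').f = x • 𝟙 (ModuleCat.of R (R ⧸ I)) := by
  refine ModuleCat.hom_ext (LinearMap.ext fun b => ?_)
  obtain ⟨b, rfl⟩ := Submodule.Quotient.mk_surjective _ b
  rfl

variable {X : ModuleCat.{u} R}

lemma ext_quotient_subsingleton_of_colon (h : ∀ a, x * a ∈ I ↔ a ∈ I')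
    (h' : I'' = I ⊔ Ideal.span {x}) {j : ℕ}
    (h₁ : Subsingleton (Ext X (ModuleCat.of R (R ⧸ I')) j))
    (h₂ : Subsingleton (Ext X (ModuleCat.of R (R ⧸ I'')) j)) :
    Subsingleton (Ext X (ModuleCat.of R (R ⧸ I)) j) := by
  refine subsingleton_of_forall_eq 0 fun e => ?_
  obtain ⟨e', rfl⟩ := Ext.covariant_sequence_exact₂ X (colonComplex_shortExact h h') e
    (h₂.elim _ _)
  rw [h₁.elim e' 0, Ext.zero_comp]

/-- Since `x` kills `X`, multiplication by `x` is zero on every `Ext X (R ⧸ I)`, so each such group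
is a quotient of the `Ext` into `R ⧸ (I, x)` one degree lower. -/
lemma ext_quotient_subsingleton_of_regular (h : ∀ a, x * a ∈ I ↔ a ∈ I)
    (h' : I'' = I ⊔ Ideal.span {x}) (hx : x ∈ Module.annihilator R X) {d : ℕ}
    (hd : ∀ j < d, Subsingleton (Ext X (ModuleCat.of R (R ⧸ I'')) j)) :
    ∀ j < d + 1, Subsingleton (Ext X (ModuleCat.of R (R ⧸ I)) j) := by
  have hf := colonComplex_f h h'
  have hz (j : ℕ) (e : Ext X (ModuleCat.of R (R ⧸ I)) j) :
      e.comp (Ext.mk₀ (colonComplex h h').f) (add_zero j) = 0 := by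
    have := Ext.postcomp_smul_id_eq_zero_of_mem_annihilator (M := ModuleCat.of R (R ⧸ I)) hx j
    rw [hf]
    exact congr($this e)
  rintro (_ | j) hj
  · refine subsingleton_of_forall_eq 0 fun e => ?_
    have := (colonComplex_shortExact h h').mono_f
    apply Ext.postcomp_mk₀_injective_of_mono X (colonComplex h h').f
    rw [map_zero]
    exact hz 0 e
  · refine subsingleton_of_forall_eq 0 fun e => ?_
    obtain ⟨e', rfl⟩ := Ext.covariant_sequence_exact₁ X (colonComplex_shortExact h h') e
      (hz _ e) rfl
    rw [(hd j (by omega)).elim e' 0, Ext.zero_comp]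

/-- A Nakayama argument: the kernel of the connecting map lies in `x • Ext`, so its image surjects
onto `Ext / x Ext`, whose support is the part of the support of `Ext` where `x` vanishes. -/
lemma mem_support_ext_succ_of_regular [IsNoetherianRing R] (h : ∀ a, x * a ∈ I ↔ a ∈ I)
    (h' : I'' = I ⊔ Ideal.span {x}) {p : PrimeSpectrum R} (hx : x ∈ p.asIdeal)
    (M : ModuleCat.{u} R) [Module.Finite R M] {i : ℕ}
    (hp : p ∈ Module.support R (Ext (ModuleCat.of R (R ⧸ I)) M i)) :
    p ∈ Module.support R (Ext (ModuleCat.of R (R ⧸ I'')) M (i + 1)) := by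
  have hf := colonComplex_f h h'
  let φ : Ext (ModuleCat.of R (R ⧸ I)) M i →ₗ[R] Ext (ModuleCat.of R (R ⧸ I'')) M (i + 1) :=
    (colonComplex_shortExact h h').extClass.precompOfLinear R M (add_comm 1 i)
  have hker : LinearMap.ker φ ≤ Ideal.span {x} • ⊤ := by
    intro e he
    obtain ⟨e', rfl⟩ := Ext.contravariant_sequence_exact₁ (colonComplex_shortExact h h') M e
      (add_comm 1 i) he
    rw [hf]
    have : (Ext.mk₀ (x • 𝟙 (ModuleCat.of R (R ⧸ I)))).comp e' (zero_add i) = x • e' := by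
      rw [Ext.mk₀_smul, Ext.smul_comp, Ext.mk₀_id_comp]
    rw [Submodule.ideal_span_singleton_smul]
    exact ⟨e', trivial, this.symm⟩
  have hq : p ∈ Module.support R (Ext (ModuleCat.of R (R ⧸ I)) M i ⧸
      (Ideal.span {x} • ⊤ : Submodule R (Ext (ModuleCat.of R (R ⧸ I)) M i))) := by
    rw [Module.support_quotient]
    refine ⟨hp, ?_⟩
    simpa using hx
  have hr : p ∈ Module.support R (LinearMap.range φ) := by
    refine Module.support_subset_of_surjective
      ((Submodule.factor hker).comp φ.quotKerEquivRange.symm.toLinearMap) ?_ hq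
    exact (Submodule.factor_surjective hker).comp φ.quotKerEquivRange.symm.surjective
  exact Module.support_subset_of_injective _ (LinearMap.range φ).injective_subtype hr

end ColonSequence

/-! ### Stanley–Reisner ideals: depth bounds from links, deletions and facets -/

section NonfaceIdeal

open Abelian MvPolynomial

variable (𝕜 : Type u) [Field 𝕜] {V : Type}

/-- The Stanley–Reisner ideal of a simplicial complex. -/
noncomputable def nonfaceIdeal (Δ : LowerSet (Finset V)) : Ideal (MvPolynomial V 𝕜) :=
  restrictSupportIdeal 𝕜 {m : V →₀ ℕ | m.support ∉ Δ} fun _ _ h hm hn =>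
    hm (Δ.lower (Finsupp.support_mono h) hn)

variable {𝕜}

lemma mem_nonfaceIdeal {Δ : LowerSet (Finset V)} {p : MvPolynomial V 𝕜} :
    p ∈ nonfaceIdeal 𝕜 Δ ↔ ∀ m ∈ p.support, m.support ∉ Δ :=
  Iff.rfl

variable [DecidableEq V]

/-- The star of a vertex. -/
def complexStar (Δ : LowerSet (Finset V)) (v : V) : LowerSet (Finset V) where
  carrier := {σ | insert v σ ∈ Δ}
  lower' _ _ h hσ := Δ.lower (Finset.insert_subset_insert v h) hσ

omit [DecidableEq V] in
/-- The deletion of a vertex. -/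
def complexDel (Δ : LowerSet (Finset V)) (v : V) : LowerSet (Finset V) where
  carrier := {σ | σ ∈ Δ ∧ v ∉ σ}
  lower' _ _ h hσ := ⟨Δ.lower h hσ.1, fun hv => hσ.2 (h hv)⟩

omit [DecidableEq V] in
lemma mem_complexDel {Δ : LowerSet (Finset V)} {v : V} {σ : Finset V} :
    σ ∈ complexDel Δ v ↔ σ ∈ Δ ∧ v ∉ σ :=
  Iff.rfl

lemma mem_complexStar {Δ : LowerSet (Finset V)} {v : V} {σ : Finset V} :
    σ ∈ complexStar Δ v ↔ insert v σ ∈ Δ :=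
  Iff.rfl

lemma complexStar_complexStar (Δ : LowerSet (Finset V)) (v : V) :
    complexStar (complexStar Δ v) v = complexStar Δ v := by
  ext σ
  simp [mem_complexStar]

lemma X_mul_mem_nonfaceIdeal (Δ : LowerSet (Finset V)) (v : V) (p : MvPolynomial V 𝕜) :
    X v * p ∈ nonfaceIdeal 𝕜 Δ ↔ p ∈ nonfaceIdeal 𝕜 (complexStar Δ v) := by
  have h (m : V →₀ ℕ) : (Finsupp.single v 1 + m).support = insert v m.support := by
    ext w
    by_cases hw : w = v <;> simp [hw, eq_comm]
  simp only [mem_nonfaceIdeal, support_X_mul, Finset.mem_map, addLeftEmbedding_apply,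
    forall_exists_index, and_imp, forall_apply_eq_imp_iff₂, h, mem_complexStar]

omit [DecidableEq V] in
lemma nonfaceIdeal_complexDel (Δ : LowerSet (Finset V)) (v : V) :
    nonfaceIdeal 𝕜 (complexDel Δ v) = nonfaceIdeal 𝕜 Δ ⊔ Ideal.span {X v} := by
  classical
  apply le_antisymm
  · intro p hp
    rw [← support_sum_monomial_coeff p]
    refine Ideal.sum_mem _ fun m hm => ?_
    by_cases hv : v ∈ m.support
    · refine Ideal.mem_sup_right (Ideal.mem_span_singleton.2 ?_)
      rw [X_dvd_monomial]
      exact Or.inr (Finsupp.mem_support_iff.1 hv)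
    · refine Ideal.mem_sup_left (mem_nonfaceIdeal.2 fun m' hm' h' => mem_nonfaceIdeal.1 hp m hm ⟨?_, hv⟩)
      rw [Finset.mem_singleton.1 (support_monomial_subset hm')] at h'
      exact h'
  · refine sup_le (fun p hp => mem_nonfaceIdeal.2 fun m hm h => mem_nonfaceIdeal.1 hp m hm h.1) ?_
    rw [Ideal.span_singleton_le_iff_mem, mem_nonfaceIdeal]
    intro m hm h
    apply h.2
    rw [support_X, Finset.mem_singleton] at hm
    simp [hm]

variable (𝕜 V) in
/-- The residue field of the polynomial ring at the origin. -/
noncomputable abbrev residueModule : ModuleCat (MvPolynomial V 𝕜) :=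
  ModuleCat.of (MvPolynomial V 𝕜)
    (MvPolynomial V 𝕜 ⧸ Ideal.span (Set.range (X : V → MvPolynomial V 𝕜)))

/-- `Ext` from the residue field to `S / I` vanishes below degree `d`. -/
def ExtVanishesBelow (I : Ideal (MvPolynomial V 𝕜)) (d : ℕ) : Prop :=
  ∀ j < d, Subsingleton (Ext (residueModule 𝕜 V) (ModuleCat.of (MvPolynomial V 𝕜) (MvPolynomial V 𝕜 ⧸ I)) j)

omit [DecidableEq V] in
lemma X_mem_annihilator_residueModule (v : V) :
    (X v : MvPolynomial V 𝕜) ∈ Module.annihilator (MvPolynomial V 𝕜) (residueModule 𝕜 V) := by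
  change _ ∈ Module.annihilator (MvPolynomial V 𝕜)
    (MvPolynomial V 𝕜 ⧸ Ideal.span (Set.range (X : V → MvPolynomial V 𝕜)))
  rw [Ideal.annihilator_quotient]
  exact Ideal.subset_span ⟨v, rfl⟩

/-- The star is a cone with apex `v` over the link, so `X v` is regular modulo its ideal and one
degree is gained over the link. The colon sequence then combines star and deletion. -/
lemma extVanishesBelow_of_link_of_del {Δ : LowerSet (Finset V)} {v : V} {d : ℕ}
    (hl : ExtVanishesBelow (nonfaceIdeal 𝕜 (complexDel (complexStar Δ v) v)) d)
    (hd : ExtVanishesBelow (nonfaceIdeal 𝕜 (complexDel Δ v)) (d + 1)) :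
    ExtVanishesBelow (nonfaceIdeal 𝕜 Δ) (d + 1) := by
  have hs : ExtVanishesBelow (nonfaceIdeal 𝕜 (complexStar Δ v)) (d + 1) :=
    ext_quotient_subsingleton_of_regular (x := X v)
      (fun a => by rw [X_mul_mem_nonfaceIdeal, complexStar_complexStar])
      (nonfaceIdeal_complexDel _ _) (X_mem_annihilator_residueModule v) hl
  exact fun j hj => ext_quotient_subsingleton_of_colon (X_mul_mem_nonfaceIdeal Δ v)
    (nonfaceIdeal_complexDel _ _) (hs j hj) (hd j hj)

omit [DecidableEq V] in
lemma nonfaceIdeal_Iic_empty :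
    nonfaceIdeal 𝕜 (LowerSet.Iic (∅ : Finset V)) =
      Ideal.span (Set.range (X : V → MvPolynomial V 𝕜)) := by
  ext p
  rw [← Set.image_univ, mem_ideal_span_X_image, mem_nonfaceIdeal]
  simp [Finsupp.ext_iff]

omit [DecidableEq V] in
lemma isPrime_span_range_X :
    (Ideal.span (Set.range (X : V → MvPolynomial V 𝕜))).IsPrime := by
  have : Ideal.span (Set.range (X : V → MvPolynomial V 𝕜)) =
      RingHom.ker (constantCoeff : MvPolynomial V 𝕜 →+* 𝕜) := by
    rw [← nonfaceIdeal_Iic_empty]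
    ext p
    rw [RingHom.mem_ker, constantCoeff_eq, mem_nonfaceIdeal]
    simp only [LowerSet.mem_Iic_iff, Finset.subset_empty,
      Finsupp.support_eq_empty]
    constructor
    · intro h
      by_contra h0
      exact h 0 (mem_support_iff.2 h0) rfl
    · rintro h0 m hm rfl
      exact mem_support_iff.1 hm h0
  rw [this]
  exact RingHom.ker_isPrime _

variable (𝕜 V) in
/-- The origin as a point of the spectrum of the polynomial ring. -/
noncomputable def originPoint : PrimeSpectrum (MvPolynomial V 𝕜) :=
  ⟨Ideal.span (Set.range X), isPrime_span_range_X⟩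

/-- Multiplication by the squarefree monomial of `σ` is well defined on the quotient by the
variables outside `σ`, because `σ` is maximal. Anything that kills this map has zero constant term.
-/
lemma origin_mem_support_hom_of_facet {Δ : LowerSet (Finset V)} {σ : Finset V} (hσ : σ ∈ Δ)
    (hmax : ∀ τ ∈ Δ, σ ⊆ τ → τ ⊆ σ) :
    originPoint 𝕜 V ∈ Module.support (MvPolynomial V 𝕜)
      (Ext (ModuleCat.of (MvPolynomial V 𝕜) (MvPolynomial V 𝕜 ⧸ nonfaceIdeal 𝕜 (LowerSet.Iic σ)))
        (ModuleCat.of (MvPolynomial V 𝕜) (MvPolynomial V 𝕜 ⧸ nonfaceIdeal 𝕜 Δ)) 0) := by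
  let n : V →₀ ℕ := Finsupp.indicator σ fun _ _ => 1
  have hn (m : V →₀ ℕ) : (m + n).support = m.support ∪ σ := by
    ext v
    by_cases hv : v ∈ σ <;> simp [n, hv, Finsupp.indicator_apply]
  let φ : (MvPolynomial V 𝕜 ⧸ nonfaceIdeal 𝕜 (LowerSet.Iic σ)) →ₗ[MvPolynomial V 𝕜]
      (MvPolynomial V 𝕜 ⧸ nonfaceIdeal 𝕜 Δ) :=
    Submodule.mapQ _ _ (LinearMap.lsmul _ _ (monomial n 1)) (by
      intro p hp
      refine mem_nonfaceIdeal.2 fun m hm hmΔ => ?_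
      rw [LinearMap.lsmul_apply, smul_eq_mul, mul_comm, mem_support_iff, coeff_mul_monomial'] at hm
      split_ifs at hm with hnm
      · obtain ⟨m, rfl⟩ := exists_add_of_le hnm
        rw [add_tsub_cancel_left, mul_one] at hm
        rw [add_comm, hn] at hmΔ
        exact mem_nonfaceIdeal.1 hp m (mem_support_iff.2 hm)
          (Finset.union_subset_iff.1 (hmax _ hmΔ Finset.subset_union_right)).1
      · exact hm rfl)
  rw [((Ext.linearEquiv₀ (R := MvPolynomial V 𝕜)).trans ModuleCat.homLinearEquiv).support_eq,
    Module.mem_support_iff']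
  refine ⟨φ, fun r hr h => hr ?_⟩
  have h1 := LinearMap.congr_fun h (Submodule.Quotient.mk 1)
  change (Submodule.Quotient.mk (r * (monomial n 1 * 1)) :
    MvPolynomial V 𝕜 ⧸ nonfaceIdeal 𝕜 Δ) = 0 at h1
  rw [Submodule.Quotient.mk_eq_zero, mul_one] at h1
  change r ∈ Ideal.span (Set.range X)
  rw [← nonfaceIdeal_Iic_empty]
  refine mem_nonfaceIdeal.2 fun m hm hm0 => ?_
  obtain rfl : m = 0 := by simpa using hm0
  refine mem_nonfaceIdeal.1 h1 n ?_ ?_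
  · rw [mem_support_iff] at hm ⊢
    rwa [coeff_mul_monomial', if_pos le_rfl, tsub_self, mul_one]
  · have := hn 0
    rw [zero_add, Finsupp.support_zero, Finset.empty_union] at this
    rwa [this]

lemma nontrivial_ext_of_facet [Finite V] {Δ : LowerSet (Finset V)} {σ : Finset V} (hσ : σ ∈ Δ)
    (hmax : ∀ τ ∈ Δ, σ ⊆ τ → τ ⊆ σ) :
    Nontrivial (Ext (residueModule 𝕜 V)
      (ModuleCat.of (MvPolynomial V 𝕜) (MvPolynomial V 𝕜 ⧸ nonfaceIdeal 𝕜 Δ)) σ.card) := by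
  -- Starting from `Hom`, the variables of `σ` are killed one at a time, each raising the degree by
  -- one; at `τ = σ` the first argument is the residue field.
  have key (τ : Finset V) : τ ⊆ σ → originPoint 𝕜 V ∈ Module.support (MvPolynomial V 𝕜)
      (Ext (ModuleCat.of (MvPolynomial V 𝕜) (MvPolynomial V 𝕜 ⧸ nonfaceIdeal 𝕜 (LowerSet.Iic (σ \ τ))))
        (ModuleCat.of (MvPolynomial V 𝕜) (MvPolynomial V 𝕜 ⧸ nonfaceIdeal 𝕜 Δ)) τ.card) := by
    induction τ using Finset.induction_on with
    | empty =>
      intro _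
      rw [Finset.sdiff_empty]
      exact origin_mem_support_hom_of_facet hσ hmax
    | insert v τ hv ih =>
      intro hτ
      rw [Finset.insert_subset_iff] at hτ
      rw [Finset.card_insert_of_notMem hv]
      refine mem_support_ext_succ_of_regular (x := X v) ?_ ?_
        (Ideal.subset_span ⟨v, rfl⟩ : X v ∈ Ideal.span (Set.range X)) _ (ih hτ.2)
      · intro a
        rw [X_mul_mem_nonfaceIdeal]
        have : complexStar (LowerSet.Iic (σ \ τ)) v = LowerSet.Iic (σ \ τ) := by
          ext ρ
          simp [mem_complexStar, Finset.insert_subset_iff, hτ.1, hv]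
        rw [this]
      · rw [← nonfaceIdeal_complexDel]
        congr 1
        ext ρ
        simp only [SetLike.mem_coe, mem_complexDel, LowerSet.mem_Iic_iff, Finset.subset_iff,
          Finset.mem_sdiff, Finset.mem_insert]
        grind
  have h := key σ subset_rfl
  rw [Finset.sdiff_self, nonfaceIdeal_Iic_empty] at h
  by_contra hn
  rw [not_nontrivial_iff_subsingleton] at hn
  rw [Module.support_eq_empty] at h
  exact h

end NonfaceIdeal

/-! ### Depth of chordal graphs -/

section IndependenceComplex

open Abelian MvPolynomial

variable {V : Type}

/-- `A` is a maximal independent set of the subgraph of `G` induced on `U`, that is, an independent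
dominating set. -/
structure IsIndepDominating (G : SimpleGraph V) (U A : Finset V) : Prop where
  subset : A ⊆ U
  indep : ∀ x ∈ A, ∀ y ∈ A, ¬ G.Adj x y
  dominating : ∀ u ∈ U, u ∉ A → ∃ w ∈ A, G.Adj w u

/-- The independence complex of the subgraph of `G` induced on `U`. -/
def indepComplex (G : SimpleGraph V) (U : Finset V) : LowerSet (Finset V) where
  carrier := {σ | σ ⊆ U ∧ ∀ x ∈ σ, ∀ y ∈ σ, ¬ G.Adj x y}
  lower' _ _ h hσ := ⟨h.trans hσ.1, fun x hx y hy => hσ.2 x (h hx) y (h hy)⟩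

lemma mem_indepComplex {G : SimpleGraph V} {U σ : Finset V} :
    σ ∈ indepComplex G U ↔ σ ⊆ U ∧ ∀ x ∈ σ, ∀ y ∈ σ, ¬ G.Adj x y :=
  Iff.rfl

lemma IsIndepDominating.facet {G : SimpleGraph V} {U A : Finset V} (h : IsIndepDominating G U A) :
    A ∈ indepComplex G U ∧ ∀ τ ∈ indepComplex G U, A ⊆ τ → τ ⊆ A := by
  refine ⟨⟨h.subset, h.indep⟩, fun τ hτ hA x hx => ?_⟩
  by_contra hxA
  obtain ⟨w, hw, hwx⟩ := h.dominating x (hτ.1 hx) hxA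
  exact hτ.2 w (hA hw) x hx hwx

lemma edgeIdeal_eq_nonfaceIdeal [Fintype V] (𝕜 : Type u) [Field 𝕜] (G : SimpleGraph V) :
    edgeIdeal 𝕜 G = nonfaceIdeal 𝕜 (indepComplex G Finset.univ) := by
  classical
  have h : {p : MvPolynomial V 𝕜 | ∃ x y, G.Adj x y ∧ p = X x * X y} =
      (fun s => monomial s (1 : 𝕜)) ''
        {s | ∃ x y, G.Adj x y ∧ s = Finsupp.single x 1 + Finsupp.single y 1} := by
    ext p
    simp only [Set.mem_ofPred_eq, Set.mem_image]
    constructor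
    · rintro ⟨x, y, hxy, rfl⟩
      exact ⟨_, ⟨x, y, hxy, rfl⟩, by simp [X, monomial_mul]⟩
    · rintro ⟨_, ⟨x, y, hxy, rfl⟩, rfl⟩
      exact ⟨x, y, hxy, by simp [X, monomial_mul]⟩
  ext p
  rw [edgeIdeal, h, mem_ideal_span_monomial_image, mem_nonfaceIdeal]
  refine forall₂_congr fun m _ => ?_
  simp only [mem_indepComplex, Finset.subset_univ, true_and, not_forall, not_not,
    Finsupp.mem_support_iff]
  constructor
  · rintro ⟨_, ⟨x, y, hxy, rfl⟩, hm⟩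
    have hx := hm x
    have hy := hm y
    simp [hxy.ne, hxy.ne'] at hx hy
    exact ⟨x, by omega, y, by omega, hxy⟩
  · rintro ⟨x, hx, y, hy, hxy⟩
    refine ⟨_, ⟨x, y, hxy, rfl⟩, fun z => ?_⟩
    have hne := hxy.ne
    by_cases hzx : z = x
    · subst hzx
      simp [hne]
      omega
    · by_cases hzy : z = y
      · subst hzy
        simp [hzx]
        omega
      · simp [hzx, hzy]

section

variable [DecidableEq V]

lemma complexDel_indepComplex (G : SimpleGraph V) (U : Finset V) (v : V) :
    complexDel (indepComplex G U) v = indepComplex G (U.erase v) := by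
  ext σ
  simp only [SetLike.mem_coe, mem_complexDel, mem_indepComplex, Finset.subset_erase]
  tauto

open Classical in
lemma complexDel_complexStar_indepComplex (G : SimpleGraph V) {U : Finset V} {v : V} (hv : v ∈ U) :
    complexDel (complexStar (indepComplex G U) v) v =
      indepComplex G {u ∈ U.erase v | ¬ G.Adj v u} := by
  ext σ
  simp only [SetLike.mem_coe, mem_complexDel, mem_complexStar, mem_indepComplex,
    hv, true_and, Finset.forall_mem_insert, Finset.subset_iff, Finset.mem_filter, Finset.mem_erase]
  have := G.adj_comm v
  have : ¬ G.Adj v v := G.irrefl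
  grind

end

/-- A weak elimination order of a chordal graph: for every vertex, the other vertices of at least
its rank that are adjacent to it are pairwise adjacent. -/
def IsEliminationRank (G : SimpleGraph V) (ρ : V → ℕ) : Prop :=
  ∀ u v w, G.Adj u v → G.Adj u w → ρ u ≤ ρ v → ρ u ≤ ρ w → v ≠ w → G.Adj v w

open Classical in
lemma extVanishesBelow_indepComplex (𝕜 : Type u) [Field 𝕜] {G : SimpleGraph V} {ρ : V → ℕ}
    (hρ : IsEliminationRank G ρ) (U : Finset V) (d : ℕ)
    (hd : ∀ A, IsIndepDominating G U A → d ≤ A.card) :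
    ExtVanishesBelow (nonfaceIdeal 𝕜 (indepComplex G U)) d := by
  induction U using Finset.strongInduction generalizing d with
  | H U ih =>
  obtain rfl | d := d
  · exact fun j hj => absurd hj (Nat.not_lt_zero j)
  have hU : U.Nonempty := by
    rw [Finset.nonempty_iff_ne_empty]
    rintro rfl
    exact absurd (hd ∅ ⟨subset_rfl, by simp, by simp⟩) (by simp)
  obtain ⟨u, hu, hmin⟩ := U.exists_min_image ρ hU
  have link (v : V) (hv : v ∈ U) : ExtVanishesBelow
      (nonfaceIdeal 𝕜 (complexDel (complexStar (indepComplex G U) v) v)) d := by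
    rw [complexDel_complexStar_indepComplex G hv]
    refine ih _ ((Finset.filter_subset _ _).trans_ssubset (Finset.erase_ssubset hv)) _
      fun A hA => ?_
    have hAU := hA.subset
    have hvA : v ∉ A := fun h => by simpa using hAU h
    -- A maximal independent set of the link becomes one of `U` on adding `v`, which accounts for
    -- the drop from `d + 1` to `d`.
    have := hd (insert v A) ⟨?_, ?_, ?_⟩
    · rw [Finset.card_insert_of_notMem hvA] at this
      omega
    · exact Finset.insert_subset hv fun x hx => by
        have := hAU hx
        simp only [Finset.mem_filter, Finset.mem_erase] at this
        exact this.1.2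
    · have hvx (x : V) (hx : x ∈ A) : ¬ G.Adj v x := (Finset.mem_filter.1 (hAU hx)).2
      simp only [Finset.forall_mem_insert]
      exact ⟨⟨G.irrefl, hvx⟩, fun x hx => ⟨fun h => hvx x hx h.symm, hA.indep x hx⟩⟩
    · intro x hx hxA
      rw [Finset.mem_insert, not_or] at hxA
      by_cases hvx : G.Adj v x
      · exact ⟨v, Finset.mem_insert_self _ _, hvx⟩
      · obtain ⟨w, hw, hwx⟩ := hA.dominating x (by simp [hx, hxA.1, hvx]) hxA.2
        exact ⟨w, Finset.mem_insert_of_mem hw, hwx⟩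
  by_cases hiso : ∃ v ∈ U, G.Adj u v
  · obtain ⟨v, hv, huv⟩ := hiso
    refine extVanishesBelow_of_link_of_del (v := v) (link v hv) ?_
    rw [complexDel_indepComplex]
    -- Deleting `v` creates no new maximal independent set: `A` contains `u` or a neighbor of `u`,
    -- and either is adjacent to `v` because the neighbors of `u` in `U` form a clique.
    refine ih _ (Finset.erase_ssubset hv) _ fun A hA => hd A ?_
    refine ⟨hA.subset.trans (Finset.erase_subset _ _), hA.indep, fun x hx hxA => ?_⟩
    by_cases hxv : x = v
    · subst hxv
      by_cases huA : u ∈ A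
      · exact ⟨u, huA, huv⟩
      · obtain ⟨w, hw, hwu⟩ := hA.dominating u (Finset.mem_erase.2 ⟨huv.ne, hu⟩) huA
        refine ⟨w, hw, hρ u w x hwu.symm huv ?_ (hmin _ hv) ?_⟩
        · exact hmin _ (Finset.mem_of_mem_erase (hA.subset hw))
        · rintro rfl
          exact hxA hw
    · exact hA.dominating x (Finset.mem_erase.2 ⟨hxv, hx⟩) hxA
  · push Not at hiso
    -- When `u` is isolated in `U`, the complex is a cone with apex `u`, so the bound for the link
    -- suffices.
    have hs : complexStar (indepComplex G U) u = indepComplex G U := by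
      ext σ
      simp only [SetLike.mem_coe, mem_complexStar, mem_indepComplex, Finset.insert_subset_iff, hu,
        true_and, Finset.forall_mem_insert]
      refine and_congr_right fun hσ => ⟨fun h x hx => (h.2 x hx).2, fun h => ?_⟩
      exact ⟨⟨G.irrefl, fun x hx => hiso x (hσ hx)⟩,
        fun x hx => ⟨fun hxu => hiso x (hσ hx) hxu.symm, h x hx⟩⟩
    have hl := link u hu
    rw [hs] at hl
    exact ext_quotient_subsingleton_of_regular (x := X u)
      (fun a => by rw [X_mul_mem_nonfaceIdeal, hs])
      (nonfaceIdeal_complexDel _ _) (X_mem_annihilator_residueModule u) hl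

/-- For a chordal graph, the depth is the least cardinality of a maximal independent set. -/
theorem graphDepth_eq_of_isEliminationRank [Fintype V] (𝕜 : Type u) [Field 𝕜] {G : SimpleGraph V}
    {ρ : V → ℕ} (hρ : IsEliminationRank G ρ) {A : Finset V}
    (hA : IsIndepDominating G Finset.univ A)
    (hmin : ∀ B, IsIndepDominating G Finset.univ B → A.card ≤ B.card) :
    graphDepth 𝕜 G = A.card := by
  classical
  have hlow := extVanishesBelow_indepComplex 𝕜 hρ Finset.univ A.card hmin
  have hne := nontrivial_ext_of_facet (𝕜 := 𝕜) hA.facet.1 hA.facet.2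
  rw [graphDepth, edgeIdeal_eq_nonfaceIdeal, depth]
  refine le_antisymm (sInf_le ⟨A.card, rfl, hne⟩) (le_sInf ?_)
  rintro _ ⟨i, rfl, hi⟩
  rw [Nat.cast_le]
  by_contra! hlt
  exact not_subsingleton_iff_nontrivial.2 hi (hlow i hlt)

end IndependenceComplex

/-! ### Maximal independent sets after gluing two graphs at a leaf -/

section StarGraph

variable {V₁ V₂ : Type} [DecidableEq V₂] {G₁ : SimpleGraph V₁} {f₁ v₁ : V₁} {G₂ : SimpleGraph V₂}
  {f₂ v₂ : V₂}

lemma starInr_self (f₁ : V₁) (f₂ : V₂) : starInr f₁ f₂ f₂ = Sum.inl f₁ := by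
  simp [starInr]

lemma starInr_of_ne {y : V₂} (h : y ≠ f₂) : starInr f₁ f₂ y = Sum.inr ⟨y, h⟩ := by
  simp [starInr, h]

lemma starInr_eq_inl {y : V₂} {x : V₁} : starInr f₁ f₂ y = Sum.inl x ↔ y = f₂ ∧ x = f₁ := by
  by_cases h : y = f₂ <;> simp [starInr, h, eq_comm]

lemma starInr_injective (f₁ : V₁) (f₂ : V₂) : Function.Injective (starInr f₁ f₂) := by
  intro x y h
  by_cases hx : x = f₂ <;> by_cases hy : y = f₂ <;> simp_all [starInr]

lemma starGraph_adj {z z' : V₁ ⊕ {y : V₂ // y ≠ f₂}} :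
    (starGraph G₁ f₁ G₂ f₂).Adj z z' ↔
      (∃ x x', G₁.Adj x x' ∧ Sum.inl x = z ∧ Sum.inl x' = z') ∨
        ∃ y y', G₂.Adj y y' ∧ starInr f₁ f₂ y = z ∧ starInr f₁ f₂ y' = z' := by
  rw [starGraph, SimpleGraph.sup_adj, SimpleGraph.map_adj', SimpleGraph.map_adj']
  constructor
  · rintro (⟨-, h⟩ | ⟨-, h⟩)
    exacts [Or.inl h, Or.inr h]
  · rintro (⟨x, x', h, rfl, rfl⟩ | ⟨y, y', h, rfl, rfl⟩)
    · exact Or.inl ⟨Sum.inl_injective.ne h.ne, x, x', h, rfl, rfl⟩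
    · exact Or.inr ⟨(starInr_injective _ _).ne h.ne, y, y', h, rfl, rfl⟩

lemma starGraph_adj_inl {x x' : V₁} :
    (starGraph G₁ f₁ G₂ f₂).Adj (Sum.inl x) (Sum.inl x') ↔ G₁.Adj x x' := by
  rw [starGraph_adj]
  constructor
  · rintro (⟨a, b, h, ha, hb⟩ | ⟨a, b, h, ha, hb⟩)
    · rwa [Sum.inl.inj ha, Sum.inl.inj hb] at h
    · rw [starInr_eq_inl] at ha hb
      exact absurd (ha.1.trans hb.1.symm) h.ne
  · exact fun h => Or.inl ⟨x, x', h, rfl, rfl⟩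

lemma starGraph_adj_starInr {y y' : V₂} :
    (starGraph G₁ f₁ G₂ f₂).Adj (starInr f₁ f₂ y) (starInr f₁ f₂ y') ↔ G₂.Adj y y' := by
  rw [starGraph_adj]
  constructor
  · rintro (⟨a, b, h, ha, hb⟩ | ⟨a, b, h, ha, hb⟩)
    · rw [eq_comm, starInr_eq_inl] at ha hb
      exact absurd (ha.2.trans hb.2.symm) h.ne
    · rwa [starInr_injective _ _ ha, starInr_injective _ _ hb] at h
  · exact fun h => Or.inr ⟨y, y', h, rfl, rfl⟩

/-- A property of all pairs of adjacent vertices of a star graph can be checked on both pieces. -/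
lemma forall_starGraph_adj {P : V₁ ⊕ {y : V₂ // y ≠ f₂} → V₁ ⊕ {y : V₂ // y ≠ f₂} → Prop} :
    (∀ z z', (starGraph G₁ f₁ G₂ f₂).Adj z z' → P z z') ↔
      (∀ x x', G₁.Adj x x' → P (Sum.inl x) (Sum.inl x')) ∧
        ∀ y y', G₂.Adj y y' → P (starInr f₁ f₂ y) (starInr f₁ f₂ y') := by
  constructor
  · exact fun h => ⟨fun x x' hx => h _ _ (starGraph_adj_inl.2 hx),
      fun y y' hy => h _ _ (starGraph_adj_starInr.2 hy)⟩
  · rintro ⟨h₁, h₂⟩ z z' h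
    obtain ⟨x, x', hx, rfl, rfl⟩ | ⟨y, y', hy, rfl, rfl⟩ := starGraph_adj.1 h
    exacts [h₁ x x' hx, h₂ y y' hy]

lemma starGraph_adj_inl_of_ne {x : V₁} (hx : x ≠ f₁) {z : V₁ ⊕ {y : V₂ // y ≠ f₂}} :
    (starGraph G₁ f₁ G₂ f₂).Adj z (Sum.inl x) ↔ ∃ x', Sum.inl x' = z ∧ G₁.Adj x' x := by
  rw [starGraph_adj]
  constructor
  · rintro (⟨a, b, h, ha, hb⟩ | ⟨a, b, h, ha, hb⟩)
    · exact ⟨a, ha, Sum.inl.inj hb ▸ h⟩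
    · exact absurd (starInr_eq_inl.1 hb).2 hx
  · rintro ⟨x', rfl, h⟩
    exact Or.inl ⟨x', x, h, rfl, rfl⟩

lemma starGraph_adj_starInr_of_ne {y : V₂} (hy : y ≠ f₂) {z : V₁ ⊕ {y : V₂ // y ≠ f₂}} :
    (starGraph G₁ f₁ G₂ f₂).Adj z (starInr f₁ f₂ y) ↔
      ∃ y', starInr f₁ f₂ y' = z ∧ G₂.Adj y' y := by
  rw [starGraph_adj]
  constructor
  · rintro (⟨a, b, h, ha, hb⟩ | ⟨a, b, h, ha, hb⟩)
    · exact absurd (starInr_eq_inl.1 hb.symm).1 hy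
    · exact ⟨a, ha, starInr_injective _ _ hb ▸ h⟩
  · rintro ⟨y', rfl, h⟩
    exact Or.inr ⟨y', y, h, rfl, rfl⟩

/-- Only the glued vertex can have neighbors on both sides. Giving it the strictly largest rank on
each side makes the ranks agree there and leaves no condition to check at it. -/
lemma isEliminationRank_starGraph {ρ₁ : V₁ → ℕ} {ρ₂ : V₂ → ℕ} {N : ℕ}
    (h₁ : IsEliminationRank G₁ ρ₁) (hf₁ : ρ₁ f₁ = N) (hN₁ : ∀ x ≠ f₁, ρ₁ x < N)
    (h₂ : IsEliminationRank G₂ ρ₂) (hf₂ : ρ₂ f₂ = N) (hN₂ : ∀ y ≠ f₂, ρ₂ y < N) :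
    IsEliminationRank (starGraph G₁ f₁ G₂ f₂) (Sum.elim ρ₁ fun y => ρ₂ y) := by
  set ρ : V₁ ⊕ {y : V₂ // y ≠ f₂} → ℕ := Sum.elim ρ₁ fun y => ρ₂ y with hρ
  have hr (y : V₂) : ρ (starInr f₁ f₂ y) = ρ₂ y := by
    by_cases hy : y = f₂
    · rw [hy, starInr_self, hf₂, ← hf₁]
      rfl
    · rw [starInr_of_ne hy]
      rfl
  intro u z w huz huw hz hw hne
  rcases u with x | y
  · by_cases hx : x = f₁
    · subst hx
      exfalso
      have hN : ∀ z z', (starGraph G₁ x G₂ f₂).Adj z z' → z = Sum.inl x → ρ z' < N := by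
        rw [forall_starGraph_adj]
        constructor
        · rintro a b hab ha
          refine hN₁ b ?_
          rintro rfl
          exact hab.ne (Sum.inl.inj ha)
        · intro a b hab ha
          rw [hr]
          refine hN₂ b ?_
          rintro rfl
          exact hab.ne (starInr_eq_inl.1 ha).1
      exact absurd (hf₁.symm.trans_le hz) (hN _ _ huz rfl).not_ge
    · obtain ⟨a, rfl, ha⟩ := (starGraph_adj_inl_of_ne hx).1 huz.symm
      obtain ⟨b, rfl, hb⟩ := (starGraph_adj_inl_of_ne hx).1 huw.symm
      rw [starGraph_adj_inl]
      exact h₁ x a b ha.symm hb.symm hz hw fun h => hne (by rw [h])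
  · obtain ⟨y, hy⟩ := y
    rw [← starInr_of_ne (f₁ := f₁) hy] at *
    obtain ⟨a, rfl, ha⟩ := (starGraph_adj_starInr_of_ne hy).1 huz.symm
    obtain ⟨b, rfl, hb⟩ := (starGraph_adj_starInr_of_ne hy).1 huw.symm
    rw [hr, hr] at hz hw
    rw [starGraph_adj_starInr]
    exact h₂ y a b ha.symm hb.symm hz hw fun h => hne (by rw [h])

variable [Fintype V₁] [Fintype V₂]

/-- An independent set that dominates all vertices except possibly `f`. -/
structure IsAlmostDominating {V : Type} (G : SimpleGraph V) (f : V) (A : Finset V) : Prop where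
  indep : ∀ x ∈ A, ∀ y ∈ A, ¬ G.Adj x y
  dominating : ∀ u, u ≠ f → u ∉ A → ∃ w ∈ A, G.Adj w u

omit [DecidableEq V₂] [Fintype V₂] in
lemma isIndepDominating_iff_of_leaf (hf : IsLeafAt G₁ f₁ v₁) {A : Finset V₁} :
    IsIndepDominating G₁ Finset.univ A ↔ IsAlmostDominating G₁ f₁ A ∧ (f₁ ∈ A ∨ v₁ ∈ A) := by
  have hadj (w : V₁) : G₁.Adj w f₁ ↔ w = v₁ := by
    rw [G₁.adj_comm, ← SimpleGraph.mem_neighborSet, hf, Set.mem_singleton_iff]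
  constructor
  · intro h
    refine ⟨⟨h.indep, fun u _ hu => h.dominating u (Finset.mem_univ u) hu⟩, ?_⟩
    by_contra! hn
    obtain ⟨w, hw, hwf⟩ := h.dominating f₁ (Finset.mem_univ _) hn.1
    exact hn.2 ((hadj w).1 hwf ▸ hw)
  · rintro ⟨h, hf⟩
    refine ⟨Finset.subset_univ _, h.indep, fun u _ hu => ?_⟩
    by_cases huf : u = f₁
    · subst huf
      exact ⟨v₁, hf.resolve_left hu, (hadj v₁).2 rfl⟩
    · exact h.dominating u huf hu

omit [DecidableEq V₂] [Fintype V₂] in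
lemma IsAlmostDominating.insert_leaf [DecidableEq V₁] (hf : IsLeafAt G₁ f₁ v₁) {A : Finset V₁}
    (hA : IsAlmostDominating G₁ f₁ A) (hv : v₁ ∉ A) :
    IsIndepDominating G₁ Finset.univ (insert f₁ A) := by
  have hadj (w : V₁) : G₁.Adj f₁ w ↔ w = v₁ := by
    rw [← SimpleGraph.mem_neighborSet, hf, Set.mem_singleton_iff]
  have hn (w : V₁) (hw : w ∈ A) : ¬ G₁.Adj f₁ w := fun h => hv ((hadj w).1 h ▸ hw)
  rw [isIndepDominating_iff_of_leaf hf]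
  refine ⟨⟨?_, fun u hu huA => ?_⟩, Or.inl (Finset.mem_insert_self _ _)⟩
  · simp only [Finset.forall_mem_insert]
    exact ⟨⟨G₁.irrefl, hn⟩, fun x hx => ⟨fun h => hn x hx h.symm, hA.indep x hx⟩⟩
  · rw [Finset.mem_insert, not_or] at huA
    obtain ⟨w, hw, hwu⟩ := hA.dominating u hu huA.2
    exact ⟨w, Finset.mem_insert_of_mem hw, hwu⟩

-- Away from the leaf, domination takes place inside one piece; the leaf itself can be dominated
-- from either side, hence the three alternatives.
open Classical in
lemma isIndepDominating_starGraph_iff (hf₁ : IsLeafAt G₁ f₁ v₁) (hf₂ : IsLeafAt G₂ f₂ v₂)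
    {B : Finset (V₁ ⊕ {y : V₂ // y ≠ f₂})} :
    IsIndepDominating (starGraph G₁ f₁ G₂ f₂) Finset.univ B ↔
      IsAlmostDominating G₁ f₁ {x | Sum.inl x ∈ B} ∧
      IsAlmostDominating G₂ f₂ {y | starInr f₁ f₂ y ∈ B} ∧
      (Sum.inl f₁ ∈ B ∨ Sum.inl v₁ ∈ B ∨ starInr f₁ f₂ v₂ ∈ B) := by
  have hadj₁ (w : V₁) : G₁.Adj w f₁ ↔ w = v₁ := by
    rw [G₁.adj_comm, ← SimpleGraph.mem_neighborSet, hf₁, Set.mem_singleton_iff]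
  have hadj₂ (w : V₂) : G₂.Adj w f₂ ↔ w = v₂ := by
    rw [G₂.adj_comm, ← SimpleGraph.mem_neighborSet, hf₂, Set.mem_singleton_iff]
  constructor
  · intro h
    refine ⟨⟨?_, fun u hu huA => ?_⟩, ⟨?_, fun u hu huA => ?_⟩, ?_⟩
    · intro x hx y hy hxy
      simp only [Finset.mem_filter, Finset.mem_univ, true_and] at hx hy
      exact h.indep _ hx _ hy (starGraph_adj_inl.2 hxy)
    · simp only [Finset.mem_filter, Finset.mem_univ, true_and] at huA
      obtain ⟨w, hw, hwu⟩ := h.dominating _ (Finset.mem_univ _) huA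
      obtain ⟨x, rfl, hxu⟩ := (starGraph_adj_inl_of_ne hu).1 hwu
      exact ⟨x, by simpa using hw, hxu⟩
    · intro x hx y hy hxy
      simp only [Finset.mem_filter, Finset.mem_univ, true_and] at hx hy
      exact h.indep _ hx _ hy (starGraph_adj_starInr.2 hxy)
    · simp only [Finset.mem_filter, Finset.mem_univ, true_and] at huA
      obtain ⟨w, hw, hwu⟩ := h.dominating _ (Finset.mem_univ _) huA
      obtain ⟨y, rfl, hyu⟩ := (starGraph_adj_starInr_of_ne hu).1 hwu
      exact ⟨y, by simpa using hw, hyu⟩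
    · by_contra! hn
      obtain ⟨w, hw, hwf⟩ := h.dominating _ (Finset.mem_univ _) hn.1
      obtain ⟨a, b, hab, rfl, hb⟩ | ⟨a, b, hab, rfl, hb⟩ := starGraph_adj.1 hwf
      · rw [Sum.inl.inj hb, hadj₁] at hab
        exact hn.2.1 (hab ▸ hw)
      · rw [(starInr_eq_inl.1 hb).1, hadj₂] at hab
        exact hn.2.2 (hab ▸ hw)
  · rintro ⟨h₁, h₂, h⟩
    refine ⟨Finset.subset_univ _, ?_, fun u _ hu => ?_⟩
    · have : ∀ z z', (starGraph G₁ f₁ G₂ f₂).Adj z z' → ¬ (z ∈ B ∧ z' ∈ B) := by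
        rw [forall_starGraph_adj]
        refine ⟨fun x x' hx hB => ?_, fun y y' hy hB => ?_⟩
        · exact h₁.indep x (by simpa using hB.1) x' (by simpa using hB.2) hx
        · exact h₂.indep y (by simpa using hB.1) y' (by simpa using hB.2) hy
      exact fun x hx y hy hxy => this x y hxy ⟨hx, hy⟩
    · rcases u with x | ⟨y, hy⟩
      · by_cases hx : x = f₁
        · subst hx
          rcases h with h | h | h
          · exact absurd h hu
          · exact ⟨_, h, starGraph_adj_inl.2 ((hadj₁ _).2 rfl)⟩
          · refine ⟨_, h, ?_⟩
            rw [← starInr_self x f₂]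
            exact starGraph_adj_starInr.2 ((hadj₂ _).2 rfl)
        · obtain ⟨w, hw, hwx⟩ := h₁.dominating x hx (by simpa using hu)
          exact ⟨Sum.inl w, by simpa using hw, starGraph_adj_inl.2 hwx⟩
      · rw [← starInr_of_ne (f₁ := f₁) hy] at *
        obtain ⟨w, hw, hwx⟩ := h₂.dominating y hy (by simpa using hu)
        exact ⟨starInr f₁ f₂ w, by simpa using hw, starGraph_adj_starInr.2 hwx⟩

open Classical in
lemma card_starGraph_pieces (B : Finset (V₁ ⊕ {y : V₂ // y ≠ f₂})) :
    Finset.card {x | Sum.inl x ∈ B} + Finset.card {y | starInr f₁ f₂ y ∈ B} =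
      B.card + if Sum.inl f₁ ∈ B then 1 else 0 := by
  set A₁ : Finset V₁ := {x | Sum.inl x ∈ B}
  set A₂ : Finset V₂ := {y | starInr f₁ f₂ y ∈ B}
  have hu : A₁.image Sum.inl ∪ A₂.image (starInr f₁ f₂) = B := by
    ext z
    simp only [A₁, A₂, Finset.mem_union, Finset.mem_image, Finset.mem_filter, Finset.mem_univ,
      true_and]
    constructor
    · rintro (⟨x, hx, rfl⟩ | ⟨y, hy, rfl⟩)
      exacts [hx, hy]
    · intro hz
      rcases z with x | ⟨y, hy⟩
      · exact Or.inl ⟨x, hz, rfl⟩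
      · exact Or.inr ⟨y, by rwa [starInr_of_ne hy], starInr_of_ne hy⟩
  have hi : A₁.image Sum.inl ∩ A₂.image (starInr f₁ f₂) =
      if Sum.inl f₁ ∈ B then {Sum.inl f₁} else ∅ := by
    ext z
    simp only [A₁, A₂, Finset.mem_inter, Finset.mem_image, Finset.mem_filter, Finset.mem_univ,
      true_and]
    constructor
    · rintro ⟨⟨x, hx, rfl⟩, ⟨y, hy, hyx⟩⟩
      rw [(starInr_eq_inl.1 hyx).2] at hx ⊢
      simp [hx]
    · split_ifs with hB
      · rw [Finset.mem_singleton]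
        rintro rfl
        exact ⟨⟨f₁, hB, rfl⟩, f₂, by rwa [starInr_self], starInr_self _ _⟩
      · simp
  have := Finset.card_union_add_card_inter (A₁.image Sum.inl) (A₂.image (starInr f₁ f₂))
  rw [hu, hi, Finset.card_image_of_injective _ Sum.inl_injective,
    Finset.card_image_of_injective _ (starInr_injective f₁ f₂)] at this
  rw [← this]
  split_ifs <;> simp

open Classical in
lemma exists_starGraph_pieces {A₁ : Finset V₁} {A₂ : Finset V₂} (h : f₁ ∈ A₁ ↔ f₂ ∈ A₂) :
    ∃ B : Finset (V₁ ⊕ {y : V₂ // y ≠ f₂}),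
      ({x | Sum.inl x ∈ B} : Finset V₁) = A₁ ∧ ({y | starInr f₁ f₂ y ∈ B} : Finset V₂) = A₂ := by
  refine ⟨Finset.univ.filter (Sum.elim (· ∈ A₁) fun y => y.1 ∈ A₂), ?_, ?_⟩
  · ext x
    simp
  · ext y
    by_cases hy : y = f₂
    · subst hy
      simp [starInr_self, h]
    · simp [starInr_of_ne hy]

/-- The least cardinality `d` of a maximal independent set of a graph with a leaf `f` attached to
`v`, where `b` tells whether it is attained by a set that contains the leaf. -/
structure LeafProfile {V : Type} [Fintype V] (G : SimpleGraph V) (f v : V) (d : ℕ) (b : Prop) :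
    Prop where
  leaf : IsLeafAt G f v
  le_card : ∀ A, IsIndepDominating G Finset.univ A → d ≤ A.card
  lt_card : ¬ b → ∀ A, IsIndepDominating G Finset.univ A → f ∈ A → d < A.card
  exists_mem : ¬ b → ∃ A, IsIndepDominating G Finset.univ A ∧ v ∈ A ∧ A.card = d
  exists_almost : b → ∃ A, IsAlmostDominating G f A ∧ f ∉ A ∧ v ∉ A ∧ A.card + 1 = d

variable {d₁ d₂ : ℕ} {b₁ b₂ : Prop}

omit [DecidableEq V₂] [Fintype V₂] in
lemma LeafProfile.exists_card_eq (h : LeafProfile G₁ f₁ v₁ d₁ b₁) :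
    ∃ A, IsIndepDominating G₁ Finset.univ A ∧ A.card = d₁ := by
  classical
  by_cases hb : b₁
  · obtain ⟨A, hA, hf, hv, hc⟩ := h.exists_almost hb
    exact ⟨_, hA.insert_leaf h.leaf hv, by rw [Finset.card_insert_of_notMem hf, hc]⟩
  · obtain ⟨A, hA, -, hc⟩ := h.exists_mem hb
    exact ⟨A, hA, hc⟩

omit [DecidableEq V₂] [Fintype V₂] in
lemma LeafProfile.leaf_notMem (h : LeafProfile G₁ f₁ v₁ d₁ b₁) {A : Finset V₁}
    (hA : IsIndepDominating G₁ Finset.univ A) (hv : v₁ ∈ A) : f₁ ∉ A := fun hf =>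
  hA.indep f₁ hf v₁ hv (by
    rw [← SimpleGraph.mem_neighborSet, h.leaf]
    exact rfl)

omit [DecidableEq V₂] [Fintype V₂] in
lemma LeafProfile.le_card_of_notMem (h : LeafProfile G₁ f₁ v₁ d₁ b₁) {A : Finset V₁}
    (hA : IsAlmostDominating G₁ f₁ A) (hf : f₁ ∉ A) (hv : v₁ ∉ A) :
    d₁ ≤ A.card + 1 ∧ (¬ b₁ → d₁ ≤ A.card) := by
  classical
  have hi := hA.insert_leaf h.leaf hv
  have hc := Finset.card_insert_of_notMem hf
  refine ⟨hc ▸ h.le_card _ hi, fun hb => ?_⟩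
  have := h.lt_card hb _ hi (Finset.mem_insert_self _ _)
  omega

-- A leaf in `B` is counted twice, at a cost of one. A leaf outside `B` is dominated by `v₁` or
-- `v₂`; if a piece lacks its own neighbor, adding the leaf makes it dominating, again at a cost of
-- one. When neither `b₁` nor `b₂` holds, strictness in `lt_card` recovers this cost.
open Classical in
lemma LeafProfile.le_card_starGraph (h₁ : LeafProfile G₁ f₁ v₁ d₁ b₁)
    (h₂ : LeafProfile G₂ f₂ v₂ d₂ b₂) {B : Finset (V₁ ⊕ {y : V₂ // y ≠ f₂})}
    (hB : IsIndepDominating (starGraph G₁ f₁ G₂ f₂) Finset.univ B) :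
    d₁ + d₂ ≤ B.card + if b₁ ∨ b₂ then 1 else 0 := by
  have hc := card_starGraph_pieces (f₁ := f₁) B
  rw [isIndepDominating_starGraph_iff h₁.leaf h₂.leaf] at hB
  set A₁ : Finset V₁ := {x | Sum.inl x ∈ B} with hA₁
  set A₂ : Finset V₂ := {y | starInr f₁ f₂ y ∈ B} with hA₂
  have hf₁ : f₁ ∈ A₁ ↔ Sum.inl f₁ ∈ B := by simp [A₁]
  have hf₂ : f₂ ∈ A₂ ↔ Sum.inl f₁ ∈ B := by simp [A₂, starInr_self]
  have hv₁ : v₁ ∈ A₁ ↔ Sum.inl v₁ ∈ B := by simp [A₁]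
  have hv₂ : v₂ ∈ A₂ ↔ starInr f₁ f₂ v₂ ∈ B := by simp [A₂]
  rw [← hf₁, ← hv₁, ← hv₂] at hB
  obtain ⟨hB₁, hB₂, hB⟩ := hB
  by_cases hf : Sum.inl f₁ ∈ B
  · rw [if_pos hf] at hc
    have hm₁ := (isIndepDominating_iff_of_leaf h₁.leaf).2 ⟨hB₁, Or.inl (hf₁.2 hf)⟩
    have hm₂ := (isIndepDominating_iff_of_leaf h₂.leaf).2 ⟨hB₂, Or.inl (hf₂.2 hf)⟩
    have l₁ := h₁.le_card _ hm₁
    have l₂ := h₂.le_card _ hm₂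
    split_ifs with hb
    · omega
    · have := h₁.lt_card (fun h => hb (Or.inl h)) _ hm₁ (hf₁.2 hf)
      omega
  · rw [if_neg hf] at hc
    have hn₁ : f₁ ∉ A₁ := fun h => hf (hf₁.1 h)
    have hn₂ : f₂ ∉ A₂ := fun h => hf (hf₂.1 h)
    by_cases hw₁ : v₁ ∈ A₁ <;> by_cases hw₂ : v₂ ∈ A₂
    · have l₁ := h₁.le_card _ ((isIndepDominating_iff_of_leaf h₁.leaf).2 ⟨hB₁, Or.inr hw₁⟩)
      have l₂ := h₂.le_card _ ((isIndepDominating_iff_of_leaf h₂.leaf).2 ⟨hB₂, Or.inr hw₂⟩)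
      omega
    · have l₁ := h₁.le_card _ ((isIndepDominating_iff_of_leaf h₁.leaf).2 ⟨hB₁, Or.inr hw₁⟩)
      have l₂ := h₂.le_card_of_notMem hB₂ hn₂ hw₂
      split_ifs with hb
      · omega
      · have := l₂.2 fun h => hb (Or.inr h)
        omega
    · have l₂ := h₂.le_card _ ((isIndepDominating_iff_of_leaf h₂.leaf).2 ⟨hB₂, Or.inr hw₂⟩)
      have l₁ := h₁.le_card_of_notMem hB₁ hn₁ hw₁
      split_ifs with hb
      · omega
      · have := l₁.2 fun h => hb (Or.inl h)
        omega
    · tauto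

-- If `b₁` and `b₂` hold, both pieces use the leaf and share it. If only one holds, that side omits
-- the leaf, which the neighbor on the other side dominates. If neither holds, both neighbors are
-- taken and nothing is shared.
open Classical in
lemma LeafProfile.exists_starGraph (h₁ : LeafProfile G₁ f₁ v₁ d₁ b₁)
    (h₂ : LeafProfile G₂ f₂ v₂ d₂ b₂) :
    ∃ B, IsIndepDominating (starGraph G₁ f₁ G₂ f₂) Finset.univ B ∧
      B.card + (if b₁ ∨ b₂ then 1 else 0) = d₁ + d₂ := by
  suffices ∃ A₁ A₂, (f₁ ∈ A₁ ↔ f₂ ∈ A₂) ∧ IsAlmostDominating G₁ f₁ A₁ ∧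
      IsAlmostDominating G₂ f₂ A₂ ∧ (f₁ ∈ A₁ ∨ v₁ ∈ A₁ ∨ v₂ ∈ A₂) ∧
      A₁.card + A₂.card + (if b₁ ∨ b₂ then 1 else 0) = d₁ + d₂ + if f₁ ∈ A₁ then 1 else 0 by
    obtain ⟨A₁, A₂, hf, hA₁, hA₂, h, hc⟩ := this
    obtain ⟨B, rfl, rfl⟩ := exists_starGraph_pieces hf
    have hB := card_starGraph_pieces (f₁ := f₁) B
    refine ⟨B, (isIndepDominating_starGraph_iff h₁.leaf h₂.leaf).2 ⟨hA₁, hA₂, ?_⟩, ?_⟩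
    · simpa using h
    · simp only [Finset.mem_filter, Finset.mem_univ, true_and] at hc
      omega
  by_cases hb₁ : b₁ <;> by_cases hb₂ : b₂
  · obtain ⟨A₁, hA₁, hf₁, hv₁, hc₁⟩ := h₁.exists_almost hb₁
    obtain ⟨A₂, hA₂, hf₂, hv₂, hc₂⟩ := h₂.exists_almost hb₂
    have hI₁ := hA₁.insert_leaf h₁.leaf hv₁
    have hI₂ := hA₂.insert_leaf h₂.leaf hv₂
    refine ⟨insert f₁ A₁, insert f₂ A₂, by simp,
      ((isIndepDominating_iff_of_leaf h₁.leaf).1 hI₁).1,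
      ((isIndepDominating_iff_of_leaf h₂.leaf).1 hI₂).1, by simp, ?_⟩
    rw [Finset.card_insert_of_notMem hf₁, Finset.card_insert_of_notMem hf₂, hc₁, hc₂]
    simp [hb₁]
  · obtain ⟨A₁, hA₁, hf₁, hv₁, hc₁⟩ := h₁.exists_almost hb₁
    obtain ⟨A₂, hA₂, hv₂, hc₂⟩ := h₂.exists_mem hb₂
    have hf₂ := h₂.leaf_notMem hA₂ hv₂
    refine ⟨A₁, A₂, by simp [hf₁, hf₂], hA₁, ((isIndepDominating_iff_of_leaf h₂.leaf).1 hA₂).1,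
      by simp [hv₂], ?_⟩
    simp only [hb₁, hf₁, true_or, if_true, if_false]
    omega
  · obtain ⟨A₂, hA₂, hf₂, hv₂, hc₂⟩ := h₂.exists_almost hb₂
    obtain ⟨A₁, hA₁, hv₁, hc₁⟩ := h₁.exists_mem hb₁
    have hf₁ := h₁.leaf_notMem hA₁ hv₁
    refine ⟨A₁, A₂, by simp [hf₁, hf₂], ((isIndepDominating_iff_of_leaf h₁.leaf).1 hA₁).1, hA₂,
      by simp [hv₁], ?_⟩
    simp only [hb₂, hf₁, or_true, if_true, if_false]
    omega
  · obtain ⟨A₁, hA₁, hv₁, hc₁⟩ := h₁.exists_mem hb₁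
    obtain ⟨A₂, hA₂, hv₂, hc₂⟩ := h₂.exists_mem hb₂
    have hf₁ := h₁.leaf_notMem hA₁ hv₁
    have hf₂ := h₂.leaf_notMem hA₂ hv₂
    refine ⟨A₁, A₂, by simp [hf₁, hf₂], ((isIndepDominating_iff_of_leaf h₁.leaf).1 hA₁).1,
      ((isIndepDominating_iff_of_leaf h₂.leaf).1 hA₂).1, by simp [hv₁], ?_⟩
    simp only [hb₁, hb₂, hf₁, or_self, if_false]
    omega

end StarGraph

/-! ### Fan graphs: elimination order and minimum maximal independent sets -/

namespace Fan

variable {n k : ℕ} (F : Fan n k)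

lemma graph_adj_inl_inl {a b : Fin n} : F.graph.Adj (Sum.inl a) (Sum.inl b) ↔ a ≠ b := by
  constructor
  · rintro h rfl
    exact h.ne rfl
  · exact fun h => ⟨Sum.inl_injective.ne h, Or.inl ⟨a, b, rfl, rfl⟩⟩

lemma w_eq_iff {i i' : Fin k} {j : Fin (F.r i)} {j' : Fin (F.r i')} :
    F.w i j = F.w i' j' ↔ (⟨i, j⟩ : (i : Fin k) × Fin (F.r i)) = ⟨i', j'⟩ :=
  F.w_injective.eq_iff (a := ⟨i, j⟩) (b := ⟨i', j'⟩)

lemma graph_adj_inr {i : Fin k} {j : Fin (F.r i)} {y : Fin (F.h i j)} {z : F.Vertex} :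
    F.graph.Adj (Sum.inr ⟨i, j, y⟩) z ↔ Sum.inr ⟨i, j, y⟩ ≠ z ∧ z ∈ F.branch i j := by
  constructor
  · rintro ⟨hne, ⟨a, b, ha, -⟩ | ⟨i', j', ⟨_, _, h⟩ | ⟨y', h⟩, hz⟩⟩
    · exact absurd ha Sum.inr_ne_inl
    · exact absurd h Sum.inr_ne_inl
    · obtain ⟨rfl, h⟩ := Sigma.mk.inj_iff.1 (Sum.inr.inj h)
      obtain ⟨rfl, -⟩ := Sigma.mk.inj_iff.1 (eq_of_heq h)
      exact ⟨hne, hz⟩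
  · rintro ⟨hne, hz⟩
    exact ⟨hne, Or.inr ⟨i, j, Or.inr ⟨y, rfl⟩, hz⟩⟩

lemma inl_mem_branch {i : Fin k} {j : Fin (F.r i)} {a : Fin n} :
    Sum.inl a ∈ F.branch i j ↔ ∃ j' ≤ j, a = F.w i j' := by
  simp [branch]

lemma inr_mem_branch {i i' : Fin k} {j : Fin (F.r i)} {j' : Fin (F.r i')} {y : Fin (F.h i j)} :
    Sum.inr ⟨i, j, y⟩ ∈ F.branch i' j' ↔
      (⟨i, j⟩ : (i : Fin k) × Fin (F.r i)) = ⟨i', j'⟩ := by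
  simp only [branch, Set.mem_ofPred_eq, reduceCtorEq, and_false, exists_false, false_or]
  constructor
  · rintro ⟨y', h⟩
    cases h
    rfl
  · intro h
    cases h
    exact ⟨y, rfl⟩

lemma graph_adj_inr_inr {i i' : Fin k} {j : Fin (F.r i)} {j' : Fin (F.r i')} {y : Fin (F.h i j)}
    {y' : Fin (F.h i' j')}
    (h : F.graph.Adj (Sum.inr ⟨i, j, y⟩) (Sum.inr ⟨i', j', y'⟩)) :
    (⟨i, j⟩ : (i : Fin k) × Fin (F.r i)) = ⟨i', j'⟩ :=
  (F.inr_mem_branch.1 (F.graph_adj_inr.1 h).2).symm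

lemma graph_adj_inr_inl {i : Fin k} {j : Fin (F.r i)} {y : Fin (F.h i j)} {a : Fin n} :
    F.graph.Adj (Sum.inr ⟨i, j, y⟩) (Sum.inl a) ↔ ∃ j' ≤ j, a = F.w i j' := by
  rw [graph_adj_inr, inl_mem_branch]
  simp

/-- The first vertex of `W_i`. -/
def head (i : Fin k) : Fin n :=
  F.w i ⟨0, F.r_pos i⟩

lemma w_eq_head_iff {i i' : Fin k} {j : Fin (F.r i)} :
    F.w i j = F.head i' ↔ i = i' ∧ j.1 = 0 := by
  rw [head, w_eq_iff]
  constructor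
  · intro h
    cases h
    exact ⟨rfl, rfl⟩
  · rintro ⟨rfl, h⟩
    congr 1
    exact Fin.ext h

variable {F} {f : F.Vertex} {v : Fin n} {c : Fin k}

lemma adj_leaf_iff (hf : IsLeafAt F.graph f (Sum.inl v)) {z : F.Vertex} :
    F.graph.Adj f z ↔ z = Sum.inl v := by
  rw [← SimpleGraph.mem_neighborSet, hf, Set.mem_singleton_iff]

/-- A new vertex is always adjacent to the head of its fan. A leaf in `K_n` is adjacent to `F.head
c` unless it equals it, and a head also has a new vertex as neighbor, contrary to `v` being the only
one. -/
lemma eq_head_of_leaf (hf : IsLeafAt F.graph f (Sum.inl v)) (hc : v ∈ F.part c) :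
    v = F.head c := by
  obtain ⟨j, -, rfl⟩ := Finset.mem_image.1 hc
  rcases f with a | ⟨i, j', y⟩
  · by_cases ha : a = F.head c
    · have : F.graph.Adj (Sum.inl a)
          (Sum.inr ⟨c, ⟨0, F.r_pos c⟩, ⟨0, F.h_pos c ⟨0, F.r_pos c⟩⟩⟩) := by
        rw [F.graph.adj_comm, graph_adj_inr_inl]
        exact ⟨_, le_rfl, ha⟩
      rw [adj_leaf_iff hf] at this
      cases this
    · exact (Sum.inl.inj ((adj_leaf_iff hf).1 (F.graph_adj_inl_inl.2 ha))).symm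
  · have : F.graph.Adj (Sum.inr ⟨i, j', y⟩) (Sum.inl (F.head i)) :=
      F.graph_adj_inr_inl.2 ⟨⟨0, F.r_pos i⟩, Nat.zero_le _, rfl⟩
    have h := Sum.inl.inj ((adj_leaf_iff hf).1 this)
    rw [← h]
    rw [eq_comm, w_eq_head_iff] at h
    rw [h.1]

variable (f v) in
/-- An elimination rank of a fan graph in which the leaf `f` comes last. -/
def rank (x : F.Vertex) : ℕ :=
  if x = f then 3 else Sum.elim (fun a => if a = v then 2 else 1) (fun _ => 0) x

lemma rank_leaf : F.rank f v f = 3 := if_pos rfl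

lemma rank_lt {x : F.Vertex} (hx : x ≠ f) : F.rank f v x < 3 := by
  rw [rank, if_neg hx]
  rcases x with a | x
  · simp only [Sum.elim_inl]
    split_ifs <;> omega
  · simp

/-- New vertices go first, since their neighbors lie in one clique, and then `K_n`. Placing `v` just
below `f` leaves `f` as its only later neighbor, so `f` can come last. -/
lemma isEliminationRank_rank (hf : IsLeafAt F.graph f (Sum.inl v)) :
    IsEliminationRank F.graph (F.rank f v) := by
  intro u z z' huz huz' hz hz' hne
  by_cases huf : u = f
  · subst huf
    have := rank_lt (v := v) huz.ne'
    rw [rank_leaf] at hz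
    omega
  rcases u with a | ⟨i, j, y⟩
  · have key (x : F.Vertex) (hax : F.graph.Adj (Sum.inl a) x)
        (hx : F.rank f v (Sum.inl a) ≤ F.rank f v x) :
        if a = v then x = f else ∃ b, x = Sum.inl b := by
      by_cases hxf : x = f
      · subst hxf
        rw [if_pos (Sum.inl.inj ((adj_leaf_iff hf).1 hax.symm))]
      · rw [rank, rank, if_neg huf, if_neg hxf] at hx
        rcases x with b | x
        · have hab := F.graph_adj_inl_inl.1 hax
          simp only [Sum.elim_inl] at hx
          grind
        · simp only [Sum.elim_inl, Sum.elim_inr] at hx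
          split_ifs at hx <;> omega
    have h := key z huz hz
    have h' := key z' huz' hz'
    split_ifs at h h'
    · exact absurd (h.trans h'.symm) hne
    · obtain ⟨b, rfl⟩ := h
      obtain ⟨b', rfl⟩ := h'
      exact F.graph_adj_inl_inl.2 fun h => hne (by rw [h])
  · exact ⟨hne, Or.inr ⟨i, j, (F.graph_adj_inr.1 huz).2, (F.graph_adj_inr.1 huz').2⟩⟩

variable (F) in
/-- The number of branch cliques. -/
def numBranches : ℕ := Fintype.card ((i : Fin k) × Fin (F.r i))

lemma exists_mem_branch {A : Finset F.Vertex} (hA : IsIndepDominating F.graph Finset.univ A)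
    (i : Fin k) (j : Fin (F.r i)) :
    (∃ y, Sum.inr ⟨i, j, y⟩ ∈ A) ∨ ∃ j' ≤ j, Sum.inl (F.w i j') ∈ A := by
  by_cases h : Sum.inr ⟨i, j, ⟨0, F.h_pos i j⟩⟩ ∈ A
  · exact Or.inl ⟨_, h⟩
  · obtain ⟨z, hz, hadj⟩ := hA.dominating _ (Finset.mem_univ _) h
    obtain ⟨j', hj', rfl⟩ | ⟨y, rfl⟩ := (F.graph_adj_inr.1 hadj.symm).2
    · exact Or.inr ⟨j', hj', hz⟩
    · exact Or.inl ⟨y, hz⟩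

/-- A branch clique that `A` does not meet inside `K_n` must contribute a new vertex, and different
cliques have disjoint new vertices. -/
lemma card_add_card_toLeft_le {A : Finset F.Vertex}
    (hA : IsIndepDominating F.graph Finset.univ A) (P : Finset ((i : Fin k) × Fin (F.r i)))
    (hP : ∀ p ∈ P, ∀ j ≤ p.2, Sum.inl (F.w p.1 j) ∉ A) :
    P.card + A.toLeft.card ≤ A.card := by
  rw [← Finset.card_toLeft_add_card_toRight (u := A), add_comm]
  refine Nat.add_le_add_left ?_ _
  refine (Finset.card_le_card (t := A.toRight.image fun x => ⟨x.1, x.2.1⟩) ?_).trans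
    Finset.card_image_le
  rintro ⟨i, j⟩ hp
  obtain ⟨y, hy⟩ | ⟨j', hj', h⟩ := exists_mem_branch hA i j
  · exact Finset.mem_image.2 ⟨⟨i, j, y⟩, Finset.mem_toRight.2 hy, rfl⟩
  · exact absurd h (hP _ hp j' hj')

lemma card_filter_branches (i : Fin k) (m : ℕ) :
    Finset.card {p : (i : Fin k) × Fin (F.r i) | ¬ (p.1 = i ∧ m ≤ p.2.1)} + (F.r i - m) =
      F.numBranches := by
  have h : Finset.card {p : (i : Fin k) × Fin (F.r i) | p.1 = i ∧ m ≤ p.2.1} = F.r i - m := by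
    have : ({p : (i : Fin k) × Fin (F.r i) | p.1 = i ∧ m ≤ p.2.1} : Finset _) =
        Finset.image (Sigma.mk i) {j : Fin (F.r i) | m ≤ j.1} := by
      ext ⟨i', j⟩
      simp only [Finset.mem_filter, Finset.mem_univ, true_and, Finset.mem_image]
      constructor
      · rintro ⟨rfl, h⟩
        exact ⟨j, h, rfl⟩
      · rintro ⟨j', h, h'⟩
        cases h'
        exact ⟨rfl, h⟩
    rw [this, Finset.card_image_of_injective _ sigma_mk_injective, ← Finset.card_map Fin.valEmbedding]
    have : (Finset.map Fin.valEmbedding {j : Fin (F.r i) | m ≤ j.1}) = Finset.Ico m (F.r i) := by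
      ext x
      simp only [Finset.mem_map, Finset.mem_filter, Finset.mem_univ, true_and,
        Fin.valEmbedding_apply, Finset.mem_Ico]
      constructor
      · rintro ⟨j, h, rfl⟩
        exact ⟨h, j.2⟩
      · exact fun h => ⟨⟨x, h.2⟩, h.1, rfl⟩
    rw [this, Nat.card_Ico]
  rw [← h, add_comm]
  exact Finset.card_filter_add_card_filter_not (s := Finset.univ) _

lemma card_toLeft_pos {A : Finset F.Vertex} {a : Fin n} (ha : Sum.inl a ∈ A) :
    1 ≤ A.toLeft.card :=
  Finset.card_pos.2 ⟨a, Finset.mem_toLeft.2 ha⟩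

lemma eq_of_inl_mem {A : Finset F.Vertex} (hA : IsIndepDominating F.graph Finset.univ A)
    {a b : Fin n} (ha : Sum.inl a ∈ A) (hb : Sum.inl b ∈ A) : a = b := by
  by_contra h
  exact hA.indep _ ha _ hb (F.graph_adj_inl_inl.2 h)

/-- The cases are: no vertex of `K_n`, one outside `W`, or some `w i j`. With positions counted from
0, `w i j` meets the `r i - j` cliques of its fan from position `j` on, and all others need a new
vertex. -/
lemma card_cases {A : Finset F.Vertex} (hA : IsIndepDominating F.graph Finset.univ A) :
    ((∀ a, Sum.inl a ∉ A) ∧ F.numBranches ≤ A.card) ∨ F.numBranches + 1 ≤ A.card ∨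
      ∃ i j, Sum.inl (F.w i j) ∈ A ∧ F.numBranches + 1 + j.1 ≤ A.card + F.r i := by
  by_cases h : ∀ a, Sum.inl a ∉ A
  · refine Or.inl ⟨h, ?_⟩
    have := card_add_card_toLeft_le hA Finset.univ fun p _ j _ => h _
    rw [Finset.card_univ] at this
    exact (Nat.le_add_right _ _).trans this
  · push Not at h
    obtain ⟨a, ha⟩ := h
    have hl := card_toLeft_pos ha
    by_cases hw : ∃ i j, F.w i j = a
    · obtain ⟨i, j, rfl⟩ := hw
      refine Or.inr (Or.inr ⟨i, j, ha, ?_⟩)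
      have h₁ := card_add_card_toLeft_le hA {p | ¬ (p.1 = i ∧ j.1 ≤ p.2.1)} (by
        rintro ⟨i', j'⟩ hp j'' hj'' hmem
        have := F.w_eq_iff.1 (eq_of_inl_mem hA ha hmem)
        cases this
        simp only [Finset.mem_filter, Finset.mem_univ, true_and, not_le] at hp
        exact absurd hj'' (not_le.2 (Fin.lt_def.2 hp)))
      have h₂ := F.card_filter_branches i j.1
      have := j.2
      omega
    · refine Or.inr (Or.inl ?_)
      have h₁ := card_add_card_toLeft_le hA Finset.univ fun p _ j _ hmem =>
        hw ⟨p.1, j, eq_of_inl_mem hA hmem ha⟩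
      rw [Finset.card_univ] at h₁
      exact (Nat.add_le_add_left hl _).trans h₁

variable (F) in
/-- The maximal independent set that contains the first vertex of `W_i` and one new vertex of every
branch clique outside the `i`-th fan. -/
def headSet (i : Fin k) : Finset F.Vertex :=
  Finset.disjSum {F.head i}
    (Finset.image (fun p : (i : Fin k) × Fin (F.r i) => ⟨p.1, p.2, ⟨0, F.h_pos p.1 p.2⟩⟩)
      {p | p.1 ≠ i})

lemma inl_mem_headSet {i : Fin k} {a : Fin n} : Sum.inl a ∈ F.headSet i ↔ a = F.head i := by
  simp [headSet]

lemma inr_mem_headSet {i i' : Fin k} {j : Fin (F.r i')} {y : Fin (F.h i' j)} :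
    Sum.inr ⟨i', j, y⟩ ∈ F.headSet i ↔ i' ≠ i ∧ y = ⟨0, F.h_pos i' j⟩ := by
  rw [headSet, Finset.inr_mem_disjSum]
  simp only [Finset.mem_image, Finset.mem_filter, Finset.mem_univ, true_and]
  constructor
  · rintro ⟨p, hp, h⟩
    cases h
    exact ⟨hp, rfl⟩
  · rintro ⟨hi, rfl⟩
    exact ⟨⟨i', j⟩, hi, rfl⟩

lemma card_headSet (i : Fin k) : (F.headSet i).card + F.r i = F.numBranches + 1 := by
  have : Finset.card {p : (i : Fin k) × Fin (F.r i) | p.1 ≠ i} + F.r i = F.numBranches := by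
    rw [← F.card_filter_branches i 0]
    simp only [Nat.zero_le, and_true, Nat.sub_zero, Ne]
  rw [headSet, Finset.card_disjSum, Finset.card_image_of_injective, Finset.card_singleton]
  · omega
  · rintro ⟨i, j⟩ ⟨i', j'⟩ h
    cases h
    rfl

lemma isIndepDominating_headSet (i : Fin k) :
    IsIndepDominating F.graph Finset.univ (F.headSet i) := by
  have hn (i' : Fin k) (j : Fin (F.r i')) (y : Fin (F.h i' j)) (a : Fin n)
      (h₁ : Sum.inr ⟨i', j, y⟩ ∈ F.headSet i) (h₂ : Sum.inl a ∈ F.headSet i) :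
      ¬ F.graph.Adj (Sum.inr ⟨i', j, y⟩) (Sum.inl a) := by
    rw [graph_adj_inr_inl, inl_mem_headSet.1 h₂]
    rintro ⟨j', -, h⟩
    exact (inr_mem_headSet.1 h₁).1 (F.w_eq_head_iff.1 h.symm).1
  refine ⟨Finset.subset_univ _, ?_, ?_⟩
  · rintro (a | ⟨i₁, j₁, y₁⟩) h₁ (b | ⟨i₂, j₂, y₂⟩) h₂ h
    · rw [graph_adj_inl_inl] at h
      exact h ((inl_mem_headSet.1 h₁).trans (inl_mem_headSet.1 h₂).symm)
    · exact hn _ _ _ _ h₂ h₁ h.symm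
    · exact hn _ _ _ _ h₁ h₂ h
    · have := F.graph_adj_inr_inr h
      cases this
      rw [inr_mem_headSet] at h₁ h₂
      rw [h₁.2, h₂.2] at h
      exact h.ne rfl
  · rintro (a | ⟨i', j, y⟩) - h
    · exact ⟨Sum.inl (F.head i), inl_mem_headSet.2 rfl,
        F.graph_adj_inl_inl.2 fun h' => h (inl_mem_headSet.2 h'.symm)⟩
    · by_cases hi : i' = i
      · subst hi
        refine ⟨Sum.inl (F.head i'), inl_mem_headSet.2 rfl, ?_⟩
        rw [F.graph.adj_comm, graph_adj_inr_inl]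
        exact ⟨_, Nat.zero_le _, rfl⟩
      · refine ⟨Sum.inr ⟨i', j, ⟨0, F.h_pos i' j⟩⟩, inr_mem_headSet.2 ⟨hi, rfl⟩, ?_⟩
        rw [F.graph.adj_comm, graph_adj_inr]
        refine ⟨fun h' => h ?_, Or.inr ⟨_, rfl⟩⟩
        rw [h']
        exact inr_mem_headSet.2 ⟨hi, rfl⟩

lemma card_part (i : Fin k) : (F.part i).card = F.r i := by
  rw [part, Finset.card_image_of_injective, Finset.card_univ, Fintype.card_fin]
  intro j j' h
  have := F.w_eq_iff.1 h
  cases this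
  rfl

lemma r_le_maxPart (i : Fin k) : F.r i ≤ F.maxPart := by
  rw [← card_part, maxPart]
  exact Finset.le_sup (f := fun i => (F.part i).card) (Finset.mem_univ i)

lemma exists_r_eq_maxPart (c : Fin k) : ∃ i, F.r i = F.maxPart := by
  obtain ⟨i, -, hi⟩ := Finset.exists_mem_eq_sup Finset.univ ⟨c, Finset.mem_univ c⟩
    fun i => (F.part i).card
  exact ⟨i, by rw [maxPart, hi, card_part]⟩

lemma maxPart_pos (c : Fin k) : 0 < F.maxPart :=
  (F.r_pos c).trans_le (r_le_maxPart c)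

lemma maxPart_le_numBranches (c : Fin k) : F.maxPart ≤ F.numBranches + 1 := by
  obtain ⟨i, hi⟩ := F.exists_r_eq_maxPart c
  rw [← hi, ← F.card_headSet i]
  exact Nat.le_add_left _ _

lemma r_eq_maxPart_of_not_exists (h : ¬ ∃ i ≠ c, F.r i = F.maxPart) : F.r c = F.maxPart := by
  obtain ⟨i, hi⟩ := F.exists_r_eq_maxPart c
  by_cases hic : i = c
  · rw [← hic, hi]
  · exact absurd ⟨i, hic, hi⟩ h

/-- Lowering part `c` by one lowers the maximum exactly when no other part attains it. Parts are
nonempty, so truncated subtraction is harmless. -/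
lemma maxPart'_ne_iff :
    (F.maxPart' c : ℤ) ≠ (F.maxPart : ℤ) - 1 ↔ ∃ i ≠ c, F.r i = F.maxPart := by
  have hpos := F.maxPart_pos c
  constructor
  · contrapose!
    intro h
    have hc : F.r c = F.maxPart :=
      r_eq_maxPart_of_not_exists (by push Not; exact h)
    have : F.maxPart' c = F.maxPart - 1 := by
      refine le_antisymm (Finset.sup_le fun i _ => ?_) ?_
      · simp only [card_part]
        split_ifs with hi
        · rw [hi, hc]
        · have := h i hi
          have := F.r_le_maxPart i
          omega
      · refine le_of_eq_of_le ?_ (Finset.le_sup (Finset.mem_univ c))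
        simp only [if_true, card_part, hc]
    omega
  · rintro ⟨i, hi, h⟩
    have : F.r i ≤ F.maxPart' c := by
      refine le_of_eq_of_le ?_ (Finset.le_sup (Finset.mem_univ i))
      simp only [if_neg hi, card_part]
    omega

/-- The set is `headSet i` without the leaf, which it must contain because it misses `v`. -/
lemma exists_almostDominating (hf : IsLeafAt F.graph f (Sum.inl v)) (hc : v ∈ F.part c)
    {i : Fin k} (hi : i ≠ c) :
    ∃ A, IsAlmostDominating F.graph f A ∧ f ∉ A ∧ Sum.inl v ∉ A ∧
      A.card + 1 + F.r i = F.numBranches + 1 := by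
  have hv := eq_head_of_leaf hf hc
  have hvn : v ≠ F.head i := by
    rw [hv, head, Ne, w_eq_head_iff]
    exact fun h => hi h.1.symm
  have hA := F.isIndepDominating_headSet i
  have hvA : Sum.inl v ∉ F.headSet i := fun h => hvn (inl_mem_headSet.1 h)
  have hfA : f ∈ F.headSet i :=
    (((isIndepDominating_iff_of_leaf hf).1 hA).2).resolve_right hvA
  refine ⟨(F.headSet i).erase f, ⟨?_, fun u hu huA => ?_⟩, Finset.notMem_erase _ _,
    fun h => hvA (Finset.mem_of_mem_erase h), ?_⟩
  · exact fun x hx y hy => hA.indep x (Finset.mem_of_mem_erase hx) y (Finset.mem_of_mem_erase hy)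
  · obtain ⟨z, hz, hzu⟩ := hA.dominating u (Finset.mem_univ _)
      fun h => huA (Finset.mem_erase.2 ⟨hu, h⟩)
    by_cases hzf : z = f
    · rw [hzf, adj_leaf_iff hf] at hzu
      subst hzu
      refine ⟨Sum.inl (F.head i), Finset.mem_erase.2 ⟨?_, inl_mem_headSet.2 rfl⟩,
        F.graph_adj_inl_inl.2 hvn.symm⟩
      intro h
      have : F.graph.Adj (Sum.inl (F.head i))
          (Sum.inr ⟨i, ⟨0, F.r_pos i⟩, ⟨0, F.h_pos i ⟨0, F.r_pos i⟩⟩⟩) := by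
        rw [F.graph.adj_comm, graph_adj_inr_inl]
        exact ⟨_, le_rfl, rfl⟩
      rw [h, adj_leaf_iff hf] at this
      exact Sum.inr_ne_inl this
    · exact ⟨z, Finset.mem_erase.2 ⟨hzf, hz⟩, hzu⟩
  · rw [Finset.card_erase_add_one hfA, card_headSet]

lemma leafProfile (hn : 2 ≤ n) (hf : IsLeafAt F.graph f (Sum.inl v)) (hc : v ∈ F.part c) :
    LeafProfile F.graph f (Sum.inl v) (F.numBranches + 1 - F.maxPart)
      (∃ i ≠ c, F.r i = F.maxPart) where
  leaf := hf
  le_card A hA := by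
    have hpos := F.maxPart_pos c
    obtain ⟨-, h⟩ | h | ⟨i, j, -, h⟩ := card_cases hA
    · omega
    · omega
    · have := F.r_le_maxPart i
      omega
  lt_card hb A hA hfA := by
    have hpos := F.maxPart_pos c
    have hle := F.maxPart_le_numBranches c
    have hrc := r_eq_maxPart_of_not_exists hb
    have hvA : Sum.inl v ∉ A := fun h => hA.indep f hfA _ h ((adj_leaf_iff hf).2 rfl)
    have hv := eq_head_of_leaf hf hc
    have hlt (i : Fin k) (hi : i ≠ c) : F.r i < F.maxPart :=
      lt_of_le_of_ne (F.r_le_maxPart i) fun h => hb ⟨i, hi, h⟩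
    obtain ⟨hno, h⟩ | h | ⟨i, j, hij, h⟩ := card_cases hA
    -- The count alone is not strict for `T = 1`. Then `v` is the only element of `W`, and since `n
    -- ≥ 2` another vertex of `K_n` has no neighbor in `A`.
    · by_cases hT : F.maxPart = 1
      · exfalso
        have : Nontrivial (Fin n) := Fin.nontrivial_iff_two_le.2 hn
        obtain ⟨a, ha⟩ := exists_ne v
        obtain ⟨b | ⟨i, j, y⟩, hz, hza⟩ := hA.dominating _ (Finset.mem_univ _) (hno a)
        · exact hno b hz
        · obtain ⟨j', -, rfl⟩ := F.graph_adj_inr_inl.1 hza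
          have hic : i = c := by
            by_contra hic
            have := hlt i hic
            have := F.r_pos i
            omega
          subst hic
          refine ha ?_
          rw [hv, w_eq_head_iff]
          have := j'.2
          exact ⟨rfl, by omega⟩
      · omega
    · omega
    · by_cases hi : i = c
      · subst hi
        -- As `A` contains the leaf it misses the head `v`, so at least one clique of this fan is
        -- not saved.
        have : j.1 ≠ 0 := fun h0 => hvA (by rwa [hv, ← F.w_eq_head_iff.2 ⟨rfl, h0⟩])
        omega
      · have := hlt i hi
        omega
  exists_mem hb := by
    refine ⟨F.headSet c, F.isIndepDominating_headSet c,
      inl_mem_headSet.2 (eq_head_of_leaf hf hc), ?_⟩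
    have := F.card_headSet c
    have := r_eq_maxPart_of_not_exists hb
    omega
  exists_almost := by
    rintro ⟨i, hi, h⟩
    obtain ⟨A, hA, hfA, hvA, hcard⟩ := exists_almostDominating hf hc hi
    exact ⟨A, hA, hfA, hvA, by omega⟩

end Fan

/-! ### From cardinalities to depths, and the theorem -/

lemma LeafProfile.graphDepth_eq {V : Type} [Fintype V] (𝕜 : Type u) [Field 𝕜] {G : SimpleGraph V}
    {f v : V} {d : ℕ} {b : Prop} (h : LeafProfile G f v d b) {ρ : V → ℕ}
    (hρ : IsEliminationRank G ρ) : graphDepth 𝕜 G = d := by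
  obtain ⟨A, hA, rfl⟩ := h.exists_card_eq
  exact graphDepth_eq_of_isEliminationRank 𝕜 hρ hA h.le_card

lemma graphDepth_starGraph_eq {V₁ V₂ : Type} [Fintype V₁] [Fintype V₂] [DecidableEq V₂]
    (𝕜 : Type u) [Field 𝕜] {G₁ : SimpleGraph V₁} {f₁ v₁ : V₁} {d₁ : ℕ} {b₁ : Prop}
    {G₂ : SimpleGraph V₂} {f₂ v₂ : V₂} {d₂ : ℕ} {b₂ : Prop}
    (h₁ : LeafProfile G₁ f₁ v₁ d₁ b₁) (h₂ : LeafProfile G₂ f₂ v₂ d₂ b₂)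
    {ρ : V₁ ⊕ {y : V₂ // y ≠ f₂} → ℕ} (hρ : IsEliminationRank (starGraph G₁ f₁ G₂ f₂) ρ) :
    ∃ d : ℕ, graphDepth 𝕜 (starGraph G₁ f₁ G₂ f₂) = d ∧
      ((b₁ ∨ b₂) → d + 1 = d₁ + d₂) ∧ (¬ (b₁ ∨ b₂) → d = d₁ + d₂) := by
  classical
  obtain ⟨B, hB, hc⟩ := h₁.exists_starGraph h₂
  refine ⟨B.card, graphDepth_eq_of_isEliminationRank 𝕜 hρ hB fun B' hB' => ?_, ?_, ?_⟩
  · have := h₁.le_card_starGraph h₂ hB'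
    omega
  · exact fun h => by rwa [if_pos h] at hc
  · exact fun h => by rwa [if_neg h] at hc

theorem mainTheorem5 (𝕜 : Type u) [Field 𝕜] (n k : Fin 2 → ℕ) (hn : ∀ i, 2 ≤ n i)
    (hk : ∀ i, 1 ≤ k i) (F : (i : Fin 2) → Fan (n i) (k i))
    -- `f i` is a leaf of the `i`-th fan graph, and `v i` is its neighbor
    (f : (i : Fin 2) → (F i).Vertex) (v : (i : Fin 2) → Fin (n i))
    (hf : ∀ i, IsLeafAt (F i).graph (f i) (Sum.inl (v i)))
    -- `c i` is the index of the part that contains `v i`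
    (c : (i : Fin 2) → Fin (k i)) (hc : ∀ i, v i ∈ (F i).part (c i))
    (T T' : Fin 2 → ℕ) (hT : ∀ i, T i = (F i).maxPart) (hT' : ∀ i, T' i = (F i).maxPart' (c i))
    (t : ℕ) (ht : t = (Finset.univ.filter fun i : Fin 2 => (T' i : ℤ) ≠ (T i : ℤ) - 1).card)
    (s : ℕ) (hs : s = if t = 0 then 0 else 1) :
    ∃ d d₁ d₂ : ℕ,
      graphDepth 𝕜 (starGraph (F 0).graph (f 0) (F 1).graph (f 1)) = d ∧
      graphDepth 𝕜 (F 0).graph = d₁ ∧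
      graphDepth 𝕜 (F 1).graph = d₂ ∧
      (d : ℤ) = (d₁ : ℤ) + (d₂ : ℤ) - (s : ℤ) := by
  have hp (i : Fin 2) := Fan.leafProfile (hn i) (hf i) (hc i)
  have hρ (i : Fin 2) := Fan.isEliminationRank_rank (hf i)
  -- This identifies `s` with the correction term of the gluing formula.
  have ht0 : t = 0 ↔ ¬ ((∃ i ≠ c 0, (F 0).r i = (F 0).maxPart) ∨
      ∃ i ≠ c 1, (F 1).r i = (F 1).maxPart) := by
    rw [ht, Finset.card_eq_zero, Finset.filter_eq_empty_iff, ← Fan.maxPart'_ne_iff,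
      ← Fan.maxPart'_ne_iff, ← hT, ← hT, ← hT', ← hT']
    simp
  obtain ⟨d, hd, h₁, h₂⟩ := graphDepth_starGraph_eq 𝕜 (hp 0) (hp 1)
    (isEliminationRank_starGraph (hρ 0) Fan.rank_leaf (fun _ => Fan.rank_lt)
      (hρ 1) Fan.rank_leaf (fun _ => Fan.rank_lt))
  refine ⟨d, _, _, hd, (hp 0).graphDepth_eq 𝕜 (hρ 0), (hp 1).graphDepth_eq 𝕜 (hρ 1), ?_⟩
  rw [hs]
  split_ifs with h
  · have := h₂ (ht0.1 h)
    omega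
  · have := h₁ (by rwa [ht0, not_not] at h)
    omega
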